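/- Let $L$ be a smooth manifold (without boundary, Hausdorff, second countable) and let $\pi:E\to L$ be a smooth real vector bundle of rank $n\ge 0$. Let $\mathfrak X_{lin}(E)$ be the space of vector fields $X\in\mathfrak X(E)$ with $X(\pi^*C^\infty(L))\subset \pi^*C^\infty(L)$ and $X(\Gamma(E^*))\subset\Gamma(E^*)$, where sections of $E^*$ are regarded as fibrewise linear functions on $E$, and let $\mathfrak{gl}(E)\to L$ be the vector bundle with $\Gamma(\mathfrak{gl}(E))=\mathfrak X_{lin}(E)$; its fibre $\mathfrak{gl}(E)_x$ is the space of restrictions to $E_x$ of the fields in $\mathfrak X_{lin}(E)$. An endomorphism $A\in\Gamma(\mathrm{End}(E))$ defines the field $a(A)\in\mathfrak X_{lin}(E)$, $a(A)(f)=\frac{d}{dt}\big|_{t=0} f\circ\exp(-tA)$, i.e. the vertical field $e\mapsto -A(e)$; this induces an inclusion $\Gamma(\pi^*(E^*\otimes E))=\Gamma(\pi^*\mathrm{End}(E))\hookrightarrow\Gamma(\pi^*\mathfrak{gl}(E))$. Let $$\mathcal F_L(E)=\{X\in\mathfrak X(E)\mid X(0_x)\in T_{0_x}L \text{ for all } x\in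 L\}$$ be the $C^\infty(E)$-module of vector fields tangent to the zero section $L\subset E$ along the zero section. Consider the complex of $C^\infty(E)$-modules $$0\to\Gamma(\pi^*(\wedge^nE^*\otimes E))\xrightarrow{d_n}\cdots\xrightarrow{d_3}\Gamma(\pi^*(\wedge^2E^*\otimes E))\xrightarrow{d_2}\Gamma(\pi^*\mathfrak{gl}(E))\xrightarrow{m}\mathcal F_L(E)\to 0,$$ where $d_k(\alpha\otimes e)=\iota_\epsilon\alpha\otimes e$ is contraction with the tautological section $\epsilon\in\Gamma(\pi^*E)$, $\epsilon(p)=p$ (in a local frame $\{e_i\}$ of $E$ with fibre coordinates $\{y^i\}$, $d_k(\alpha\otimes e)=\sum_i y^i\,\iota_{e_i}\alpha\otimes e$), where $d_2$, which takes values in $\Gamma(\pi^*(E^*\otimes E))$, is followed by the above inclusion into $\Gamma(\pi^*\mathfrak{gl}(E))$, and where $m(f\otimes X)=fX$ for $f\in C^\infty(E)$, $X\in\mathfrak X_{lin}(E)$. This complex is exact at every place: $m$ is surjective onto $\mathcal F_L(E)$, $\ker m=\operatorname{im} d_2$, $\ker d_k=\operatorname{im} d_{k+1}$ for $2\le k\le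 n-1$, and, if $n\ge 2$, $d_n$ is injective. (If $n\le 1$ there are no terms $\wedge^kE^*\otimes E$ with $k\ge2$, and the assertion is that $m$ is an isomorphism.) -/

import Mathlib

open Bundle Filter Topology
open scoped Manifold ContDiff Bundle

noncomputable section

set_option linter.unusedSectionVars false

namespace ZeroSectionFoliation

section Modules
variable {EM : Type*} [NormedAddCommGroup EM] [NormedSpace ℝ EM] {H : Type*} [TopologicalSpace H]
  {I : ModelWithCorners ℝ EM H} {M : Type*} [TopologicalSpace M] [ChartedSpace H M]

/-- Families of vectors over a manifold form a module over the smooth functions, pointwise. -/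
instance familyModule {V : M → Type*} [∀ x, AddCommGroup (V x)] [∀ x, Module ℝ (V x)] :
    Module C^∞⟮I, M; ℝ⟯ (∀ x, V x) :=
  Module.compHom (∀ x, V x) (ContMDiffMap.coeFnRingHom : C^∞⟮I, M; ℝ⟯ →+* (M → ℝ))

theorem family_smul_apply {V : M → Type*} [∀ x, AddCommGroup (V x)] [∀ x, Module ℝ (V x)]
    (f : C^∞⟮I, M; ℝ⟯) (s : ∀ x, V x) (x : M) : (f • s) x = f x • s x := rfl

variable {F : Type*} [NormedAddCommGroup F] [NormedSpace ℝ F] {V : M → Type*}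
  [TopologicalSpace (TotalSpace F V)] [∀ x, TopologicalSpace (V x)] [FiberBundle F V]
  [∀ x, AddCommGroup (V x)] [∀ x, Module ℝ (V x)] [VectorBundle ℝ F V]

/-- Pointwise product of a smooth function with a smooth section. -/
instance sectionSMul : SMul C^∞⟮I, M; ℝ⟯ Cₛ^∞⟮I; F, V⟯ :=
  ⟨fun f s => ⟨fun x => f x • s x, f.contMDiff.smul_section s.contMDiff⟩⟩

theorem section_smul_apply (f : C^∞⟮I, M; ℝ⟯) (s : Cₛ^∞⟮I; F, V⟯) (x : M) :
    (f • s) x = f x • s x := rfl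

/-- Smooth sections of a vector bundle form a module over the smooth functions. -/
instance sectionModule : Module C^∞⟮I, M; ℝ⟯ Cₛ^∞⟮I; F, V⟯ :=
  ContMDiffSection.coe_injective.module _ (ContMDiffSection.coeAddHom I F ∞ V) fun _ _ => rfl
end Modules

section Contraction
variable {V W : Type*} [AddCommGroup V] [Module ℝ V] [TopologicalSpace V]
  [AddCommGroup W] [Module ℝ W] [TopologicalSpace W]

/-- The interior product `ι_v α = α(v, ·, …, ·)` of a vector-valued alternating form. -/
def interior {k : ℕ} (v : V) (α : V [⋀^Fin (k + 1)]→L[ℝ] W) : V [⋀^Fin k]→L[ℝ] W :=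
  { α.toAlternatingMap.curryLeft v with
    cont := α.cont.comp (continuous_const.matrixVecCons continuous_id) }

theorem interior_apply {k : ℕ} (v : V) (α : V [⋀^Fin (k + 1)]→L[ℝ] W) (w : Fin k → V) :
    interior v α w = α (Matrix.vecCons v w) := rfl

theorem contDiff_curryLeft {F : Type*} [NormedAddCommGroup F] [NormedSpace ℝ F] (k : ℕ) :
    ContDiff ℝ ∞ (fun z : (F [⋀^Fin (k + 1)]→L[ℝ] F) × F => z.1.curryLeft z.2) := by
  let c : (F [⋀^Fin (k + 1)]→L[ℝ] F) →L[ℝ] (F →L[ℝ] (F [⋀^Fin k]→L[ℝ] F)) :=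
    (ContinuousAlternatingMap.curryLeftLI (𝕜 := ℝ) (E := F) (F := F)
      (n := k)).toContinuousLinearMap
  exact c.isBoundedBilinearMap.contDiff

end Contraction

section Bundle
variable {EB : Type*} [NormedAddCommGroup EB] [NormedSpace ℝ EB] {B : Type*} [TopologicalSpace B]
  [ChartedSpace EB B]
  (F : Type*) [NormedAddCommGroup F] [NormedSpace ℝ F] (E : B → Type*)
  [TopologicalSpace (TotalSpace F E)] [∀ x, AddCommGroup (E x)] [∀ x, Module ℝ (E x)]
  [∀ x, TopologicalSpace (E x)] [FiberBundle F E] [VectorBundle ℝ F E]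

local notation "IE" => ModelWithCorners.prod (modelWithCornersSelf ℝ EB) (modelWithCornersSelf ℝ F)

variable (EB) in
/-- The ring `C^∞(E)` of smooth functions on the total space of the vector bundle `E`. -/
abbrev TotalFunctions := C^∞⟮IE, TotalSpace F E; ℝ⟯

section Pullback
variable (G : Type*) [NormedAddCommGroup G] [NormedSpace ℝ G] (V : B → Type*)
  [TopologicalSpace (TotalSpace G V)] [∀ x, AddCommGroup (V x)] [∀ x, Module ℝ (V x)]
  [∀ x, TopologicalSpace (V x)] [FiberBundle G V] [VectorBundle ℝ G V]

variable (EB) in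
/-- The `C^∞(E)`-module `Γ(π*V)` of smooth sections of the pullback of a vector bundle `V → B` along
the projection `π : E → B`: families `s p ∈ V (π p)` that are smooth as maps `E → V` over `π`. -/
def pullbackSections : Submodule (TotalFunctions EB F E) (∀ p : TotalSpace F E, V p.proj) where
  carrier := {s | ContMDiff IE (𝓘(ℝ, EB).prod 𝓘(ℝ, G)) ∞
    (fun p : TotalSpace F E => (⟨p.proj, s p⟩ : TotalSpace G V))}
  zero_mem' := (contMDiff_zeroSection ℝ V).comp (contMDiff_proj E)
  add_mem' := by
    intro s t hs ht p₀
    have hs' := contMDiffAt_totalSpace.1 (hs p₀)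
    have ht' := contMDiffAt_totalSpace.1 (ht p₀)
    refine contMDiffAt_totalSpace.2 ⟨hs'.1, (hs'.2.add ht'.2).congr_of_eventuallyEq ?_⟩
    have := (FiberBundle.continuous_proj F E).continuousAt.preimage_mem_nhds
      ((trivializationAt G V p₀.proj).open_baseSet.mem_nhds
        (FiberBundle.mem_baseSet_trivializationAt' p₀.proj))
    filter_upwards [this] with p hp
    exact ((trivializationAt G V p₀.proj).linear ℝ hp).1 _ _
  smul_mem' := by
    intro f s hs p₀
    have hs' := contMDiffAt_totalSpace.1 (hs p₀)
    refine contMDiffAt_totalSpace.2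
      ⟨hs'.1, ((f.contMDiff p₀).smul hs'.2).congr_of_eventuallyEq ?_⟩
    have := (FiberBundle.continuous_proj F E).continuousAt.preimage_mem_nhds
      ((trivializationAt G V p₀.proj).open_baseSet.mem_nhds
        (FiberBundle.mem_baseSet_trivializationAt' p₀.proj))
    filter_upwards [this] with p hp
    exact ((trivializationAt G V p₀.proj).linear ℝ hp).2 _ _
end Pullback

variable (EB) in
/-- The smooth sections `Γ(E*)` of the dual bundle, that is, the fibrewise linear smooth functions. -/
abbrev DualSections :=
  Cₛ^∞⟮𝓘(ℝ, EB); F →L[ℝ] ℝ, fun x : B => E x →L[ℝ] Bundle.Trivial B ℝ x⟯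

variable {F E}
variable (EB) in
/-- The vertical tangent vector at `p` given by `v ∈ E (π p)`: the velocity at `t = 0` of the line
`t ↦ p + t v` in the fibre through `p`. -/
def verticalLift (p : TotalSpace F E) (v : E p.proj) : TangentSpace IE p :=
  mfderiv 𝓘(ℝ, ℝ) IE (fun t : ℝ => (⟨p.proj, p.2 + t • v⟩ : TotalSpace F E)) 0 (1 : ℝ)

theorem contMDiff_line (p : TotalSpace F E) (v : E p.proj) :
    ContMDiff 𝓘(ℝ, ℝ) IE ∞ (fun t : ℝ => (⟨p.proj, p.2 + t • v⟩ : TotalSpace F E)) := by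
  intro t₀
  refine contMDiffAt_totalSpace.2 ⟨contMDiffAt_const, ?_⟩
  have hx := FiberBundle.mem_baseSet_trivializationAt' (F := F) (E := E) p.proj
  have hl := (trivializationAt F E p.proj).linear ℝ hx
  have : ContMDiffAt 𝓘(ℝ, ℝ) 𝓘(ℝ, F) ∞ (fun t : ℝ =>
      (trivializationAt F E p.proj ⟨p.proj, p.2⟩).2 +
        t • (trivializationAt F E p.proj ⟨p.proj, v⟩).2) t₀ := by
    apply ContDiffAt.contMDiffAt
    fun_prop
  refine this.congr_of_eventuallyEq (Eventually.of_forall fun t => ?_)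
  exact (hl.1 _ _).trans (congrArg _ (hl.2 _ _))

theorem verticalLift_eq (p : TotalSpace F E) (v : E p.proj) :
    verticalLift EB p v =
      ((0 : EB), (trivializationAt F E p.proj).continuousLinearMapAt ℝ p.proj v) := by
  have hx := FiberBundle.mem_baseSet_trivializationAt' (F := F) (E := E) p.proj
  have hd : MDifferentiableAt 𝓘(ℝ, ℝ) IE
      (fun t : ℝ => (⟨p.proj, p.2 + t • v⟩ : TotalSpace F E)) 0 :=
    (contMDiff_line p v).mdifferentiable (by simp) 0
  set L := (trivializationAt F E p.proj).continuousLinearMapAt ℝ p.proj with hL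
  have key : writtenInExtChartAt 𝓘(ℝ, ℝ) IE (0 : ℝ)
      (fun t : ℝ => (⟨p.proj, p.2 + t • v⟩ : TotalSpace F E)) =
      fun t : ℝ => ((chartAt EB p.proj p.proj : EB), L p.2 + t • L v) := by
    funext t
    have : ∀ w : E p.proj, (trivializationAt F E p.proj ⟨p.proj, w⟩).2 = L w := fun w => by
      rw [hL, Trivialization.continuousLinearMapAt_apply,
        Trivialization.coe_linearMapAt_of_mem _ hx]
    refine Prod.ext ?_ ?_ <;>
      simp only [writtenInExtChartAt, FiberBundle.chartedSpace_chartAt, mfld_simps]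
    · change chartAt EB p.proj (trivializationAt F E p.proj ⟨p.proj, p.2 + t • v⟩).1 = _
      exact congrArg _ (Trivialization.coe_fst' _ hx)
    · change (trivializationAt F E p.proj ⟨p.proj, p.2 + t • v⟩).2 = _
      rw [this, map_add, map_smul]
  have hder : HasFDerivAt (fun t : ℝ => ((chartAt EB p.proj p.proj : EB), L p.2 + t • L v))
      ((0 : ℝ →L[ℝ] EB).prod ((ContinuousLinearMap.id ℝ ℝ).smulRight (L v))) 0 := by
    refine (hasFDerivAt_const _ _).prodMk ?_
    exact ((hasFDerivAt_id (𝕜 := ℝ) (0:ℝ)).smul_const (L v)).const_add _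
  have hm : HasMFDerivAt 𝓘(ℝ, ℝ) IE
      (fun t : ℝ => (⟨p.proj, p.2 + t • v⟩ : TotalSpace F E)) 0
      ((0 : ℝ →L[ℝ] EB).prod ((ContinuousLinearMap.id ℝ ℝ).smulRight (L v))) := by
    refine ⟨hd.continuousAt, ?_⟩
    rw [key]
    exact hder.hasFDerivWithinAt
  unfold verticalLift
  rw [hm.mfderiv]
  change (((0 : ℝ →L[ℝ] EB) (1 : ℝ)), (1 : ℝ) • L v) = _
  simp

theorem verticalLift_add (p : TotalSpace F E) (v w : E p.proj) :
    verticalLift EB p (v + w) = verticalLift EB p v + verticalLift EB p w := by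
  simp only [verticalLift_eq, map_add]
  exact Prod.ext (add_zero _).symm rfl

theorem verticalLift_smul (p : TotalSpace F E) (c : ℝ) (v : E p.proj) :
    verticalLift EB p (c • v) = c • verticalLift EB p v := by
  simp only [verticalLift_eq, map_smul]
  exact Prod.ext (smul_zero _).symm rfl

theorem mfderiv_verticalLift {f : TotalSpace F E → ℝ} {p : TotalSpace F E}
    (hf : MDifferentiableAt IE 𝓘(ℝ, ℝ) f p) (v : E p.proj) :
    mfderiv IE 𝓘(ℝ, ℝ) f p (verticalLift EB p v) =
      deriv (fun t : ℝ => f ⟨p.proj, p.2 + t • v⟩) 0 := by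
  have hd : MDifferentiableAt 𝓘(ℝ, ℝ) IE
      (fun t : ℝ => (⟨p.proj, p.2 + t • v⟩ : TotalSpace F E)) 0 :=
    (contMDiff_line p v).mdifferentiable (by simp) 0
  have h0 : (⟨p.proj, p.2 + (0 : ℝ) • v⟩ : TotalSpace F E) = p := by simp
  have hf' : MDifferentiableAt IE 𝓘(ℝ, ℝ) f (⟨p.proj, p.2 + (0 : ℝ) • v⟩ : TotalSpace F E) := by
    rw [h0]; exact hf
  have hc := mfderiv_comp (0 : ℝ) hf' hd
  have : deriv (fun t : ℝ => f ⟨p.proj, p.2 + t • v⟩) 0 =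
      mfderiv 𝓘(ℝ, ℝ) 𝓘(ℝ, ℝ)
        (f ∘ fun t : ℝ => (⟨p.proj, p.2 + t • v⟩ : TotalSpace F E)) 0 (1 : ℝ) := by
    rw [mfderiv_eq_fderiv, ← fderiv_apply_one_eq_deriv]; rfl
  rw [this, hc]
  have h1 : ∀ q : TotalSpace F E, q = p →
    (mfderiv IE 𝓘(ℝ, ℝ) f p : EB × F →L[ℝ] ℝ) = mfderiv IE 𝓘(ℝ, ℝ) f q := by
    rintro q rfl; rfl
  exact congrArg (fun A : EB × F →L[ℝ] ℝ => A (verticalLift EB p v)) (h1 _ h0)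

variable [IsManifold 𝓘(ℝ, EB) ∞ B] [ContMDiffVectorBundle ∞ F E 𝓘(ℝ, EB)]

variable (EB F E) in
/-- The smooth vector fields `𝔛(E)` on the total space. -/
abbrev VectorFields :=
  Cₛ^∞⟮IE; EB × F, (TangentSpace IE : TotalSpace F E → Type _)⟯

theorem contMDiff_verticalLift {s : ∀ p : TotalSpace F E, E p.proj}
    (hs : s ∈ pullbackSections EB F E F E) :
    ContMDiff IE (ModelWithCorners.prod IE 𝓘(ℝ, EB × F)) ∞
      (fun p => (⟨p, verticalLift EB p (s p)⟩ :
        TotalSpace (EB × F) (TangentSpace IE : TotalSpace F E → Type _))) := by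
  let Φ : TotalSpace F E × ℝ → TotalSpace F E := fun z => ⟨z.1.proj, z.1.2 + z.2 • s z.1⟩
  have hΦ : ContMDiff (ModelWithCorners.prod IE 𝓘(ℝ, ℝ)) IE ∞ Φ := by
    intro z₀
    refine contMDiffAt_totalSpace.2 ⟨((contMDiff_proj E).comp contMDiff_fst) z₀, ?_⟩
    have h1 := (contMDiffAt_totalSpace.1 (contMDiff_id (I := IE) (n := ∞) z₀.1)).2
    have h2 := (contMDiffAt_totalSpace.1 (hs z₀.1)).2
    have h3 : ContMDiffAt (ModelWithCorners.prod IE 𝓘(ℝ, ℝ)) 𝓘(ℝ, F) ∞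
        (fun z : TotalSpace F E × ℝ => (trivializationAt F E z₀.1.proj z.1).2 +
          z.2 • (trivializationAt F E z₀.1.proj ⟨z.1.proj, s z.1⟩).2) z₀ :=
      (h1.comp z₀ contMDiffAt_fst).add (contMDiffAt_snd.smul (h2.comp z₀ contMDiffAt_fst))
    refine h3.congr_of_eventuallyEq ?_
    have := ((FiberBundle.continuous_proj F E).comp continuous_fst).continuousAt.preimage_mem_nhds
      ((trivializationAt F E z₀.1.proj).open_baseSet.mem_nhds
        (FiberBundle.mem_baseSet_trivializationAt' z₀.1.proj))
    filter_upwards [this] with z hz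
    have hl := (trivializationAt F E z₀.1.proj).linear ℝ hz
    exact (hl.1 _ _).trans (congrArg _ (hl.2 _ _))
  have hT := hΦ.contMDiff_tangentMap (m := ∞) (by simp)
  have h0 : ContMDiff IE (ModelWithCorners.prod IE 𝓘(ℝ, EB × F)) ∞
      (fun p : TotalSpace F E => (⟨p, 0⟩ : TangentBundle IE (TotalSpace F E))) :=
    contMDiff_zeroSection ℝ (TangentSpace IE : TotalSpace F E → Type _)
  have h1 : ContMDiff IE (ModelWithCorners.prod 𝓘(ℝ, ℝ) 𝓘(ℝ, ℝ)) ∞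
      (fun _ : TotalSpace F E => (⟨0, (1 : ℝ)⟩ : TangentBundle 𝓘(ℝ, ℝ) ℝ)) := contMDiff_const
  have hS := (hT.comp contMDiff_equivTangentBundleProd_symm).comp (h0.prodMk h1)
  have hpt : ∀ p : TotalSpace F E, (⟨p, verticalLift EB p (s p)⟩ :
      TotalSpace (EB × F) (TangentSpace IE : TotalSpace F E → Type _)) =
      ⟨Φ (p, 0), verticalLift EB p (s p)⟩ := by
    intro p
    have h : p = Φ (p, 0) := by simp [Φ]
    exact congrArg (fun q : TotalSpace F E => (⟨q, (verticalLift EB p (s p) : EB × F)⟩ :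
      TotalSpace (EB × F) (TangentSpace IE : TotalSpace F E → Type _))) h
  refine hS.congr fun p => (hpt p).trans ?_
  refine congrArg (fun v : EB × F => (⟨Φ (p, 0), v⟩ :
      TotalSpace (EB × F) (TangentSpace IE : TotalSpace F E → Type _))) ?_
  have hd := hΦ.mdifferentiable (by simp) (p, (0 : ℝ))
  have hc : MDifferentiableAt 𝓘(ℝ, ℝ) (ModelWithCorners.prod IE 𝓘(ℝ, ℝ))
      (fun t : ℝ => (p, t)) 0 := mdifferentiableAt_const.prodMk mdifferentiableAt_id
  have hcomp := mfderiv_comp (0 : ℝ) hd hc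
  have : mfderiv 𝓘(ℝ, ℝ) (ModelWithCorners.prod IE 𝓘(ℝ, ℝ)) (fun t : ℝ => (p, t)) 0 (1 : ℝ) =
      ((0 : EB × F), (1 : ℝ)) := by
    have h := (hasMFDerivAt_const (I := 𝓘(ℝ, ℝ)) (I' := IE) p (0 : ℝ)).prodMk
      (hasMFDerivAt_id (I := 𝓘(ℝ, ℝ)) (0 : ℝ))
    exact congrArg (fun A : ℝ →L[ℝ] (EB × F) × ℝ => A 1) h.mfderiv
  change mfderiv 𝓘(ℝ, ℝ) IE (Φ ∘ fun t : ℝ => (p, t)) 0 (1 : ℝ) = _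
  rw [hcomp]
  exact congrArg (mfderiv (ModelWithCorners.prod IE 𝓘(ℝ, ℝ)) IE Φ (p, (0 : ℝ))) this

variable (EB F E) in
/-- The space `𝔛_lin(E)` of vector fields on the total space which, as derivations, preserve the
fibrewise constant functions `π*C^∞(B)` and the fibrewise linear functions `Γ(E*)`. -/
def linearFields : Submodule ℝ (VectorFields EB F E) where
  carrier := {X | (∀ g : C^∞⟮𝓘(ℝ, EB), B; ℝ⟯, ∃ h : C^∞⟮𝓘(ℝ, EB), B; ℝ⟯, ∀ p : TotalSpace F E,
    mfderiv IE 𝓘(ℝ, ℝ) (fun q : TotalSpace F E => g q.proj) p (X p) = h p.proj) ∧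
    (∀ φ : DualSections EB F E, ∃ ψ : DualSections EB F E, ∀ p : TotalSpace F E,
    mfderiv IE 𝓘(ℝ, ℝ) (fun q : TotalSpace F E => (φ q.proj q.2 : ℝ)) p (X p) = ψ p.proj p.2)}
  zero_mem' := by
    refine ⟨fun g => ⟨0, fun p => ?_⟩, fun φ => ⟨0, fun p => ?_⟩⟩
    · exact map_zero _
    · exact map_zero _
  add_mem' := by
    rintro X Y ⟨hX, hX'⟩ ⟨hY, hY'⟩
    refine ⟨fun g => ?_, fun φ => ?_⟩
    · obtain ⟨h, hh⟩ := hX g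
      obtain ⟨h', hh'⟩ := hY g
      exact ⟨h + h', fun p => (map_add _ _ _).trans (congrArg₂ (· + ·) (hh p) (hh' p))⟩
    · obtain ⟨h, hh⟩ := hX' φ
      obtain ⟨h', hh'⟩ := hY' φ
      exact ⟨h + h', fun p => (map_add _ _ _).trans (congrArg₂ (· + ·) (hh p) (hh' p))⟩
  smul_mem' := by
    rintro c X ⟨hX, hX'⟩
    refine ⟨fun g => ?_, fun φ => ?_⟩
    · obtain ⟨h, hh⟩ := hX g
      exact ⟨c • h, fun p => (map_smul _ _ _).trans (congrArg (c • ·) (hh p))⟩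
    · obtain ⟨h, hh⟩ := hX' φ
      exact ⟨c • h, fun p => (map_smul _ _ _).trans (congrArg (c • ·) (hh p))⟩


variable [∀ x, IsTopologicalAddGroup (E x)] [∀ x, ContinuousSMul ℝ (E x)]

variable (EB F E) in
/-- The smooth sections `Γ(End E)`. -/
abbrev EndSections :=
  Cₛ^∞⟮𝓘(ℝ, EB); F →L[ℝ] F, fun x : B => E x →L[ℝ] E x⟯

theorem endSection_pull (A : EndSections EB F E) :
    (fun p : TotalSpace F E => -(A p.proj p.2)) ∈ pullbackSections EB F E F E := by
  have h1 : ContMDiff IE (𝓘(ℝ, EB).prod 𝓘(ℝ, F)) ∞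
      (fun p : TotalSpace F E => (⟨p.proj, A p.proj p.2⟩ : TotalSpace F E)) := by
    intro p
    exact ContMDiffAt.clm_bundle_apply (b := fun p : TotalSpace F E => p.proj)
      (ϕ := fun p : TotalSpace F E => A p.proj) (v := fun p : TotalSpace F E => p.2)
      ((A.contMDiff.comp (contMDiff_proj E)) p) contMDiffAt_id
  exact (pullbackSections EB F E F E).neg_mem (x := fun p => A p.proj p.2) h1

/-- The vector field `a(A)` given by a section `A` of `End E`: it is `e ↦ -A e`, regarded as a vertical
vector field, so that `a(A)(f) = d/dt|₀ f ∘ exp(-t A)`. -/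
def endField (A : EndSections EB F E) : VectorFields EB F E :=
  ⟨fun p => verticalLift EB p (-(A p.proj p.2)), contMDiff_verticalLift (endSection_pull A)⟩

theorem contMDiff_pairing (φ : DualSections EB F E) :
    ContMDiff IE 𝓘(ℝ, ℝ) ∞ (fun q : TotalSpace F E => (φ q.proj q.2 : ℝ)) := by
  intro p
  have h : ContMDiffAt IE (𝓘(ℝ, EB).prod 𝓘(ℝ, ℝ)) ∞
      (fun p : TotalSpace F E => (⟨p.proj, φ p.proj p.2⟩ : TotalSpace ℝ (Bundle.Trivial B ℝ))) p :=
    ContMDiffAt.clm_bundle_apply (b := fun p : TotalSpace F E => p.proj)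
      (E₂ := Bundle.Trivial B ℝ)
      (ϕ := fun p : TotalSpace F E => φ p.proj) (v := fun p : TotalSpace F E => p.2)
      ((φ.contMDiff.comp (contMDiff_proj E)) p) contMDiffAt_id
  exact (contMDiffAt_totalSpace.1 h).2

theorem contMDiff_dual_comp (φ : DualSections EB F E) (A : EndSections EB F E) :
    ContMDiff 𝓘(ℝ, EB) (𝓘(ℝ, EB).prod 𝓘(ℝ, F →L[ℝ] ℝ)) ∞
      (fun x : B => (⟨x, -((φ x).comp (A x))⟩ :
        TotalSpace (F →L[ℝ] ℝ) (fun x : B => E x →L[ℝ] Bundle.Trivial B ℝ x))) := by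
  intro x₀
  have h1 := ((contMDiffAt_hom_bundle _).1 (φ.contMDiff x₀)).2
  have h2 := ((contMDiffAt_hom_bundle _).1 (A.contMDiff x₀)).2
  refine (contMDiffAt_hom_bundle _).2 ⟨contMDiffAt_id, ?_⟩
  refine ((h1.clm_comp h2).neg).congr_of_eventuallyEq ?_
  filter_upwards [(trivializationAt F E x₀).open_baseSet.mem_nhds
    (FiberBundle.mem_baseSet_trivializationAt' x₀)] with x hx
  ext v
  simp [ContinuousLinearMap.inCoordinates, hx]

theorem endField_mem (A : EndSections EB F E) : endField A ∈ linearFields EB F E := by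
  refine ⟨fun g => ⟨0, fun p => ?_⟩, fun φ => ⟨⟨_, contMDiff_dual_comp φ A⟩, fun p => ?_⟩⟩
  · have hg : ContMDiff IE 𝓘(ℝ, ℝ) ∞ (fun q : TotalSpace F E => g q.proj) :=
      g.contMDiff.comp (contMDiff_proj E)
    refine (mfderiv_verticalLift (hg.mdifferentiable (by simp) p) _).trans ?_
    simp
    rfl
  · refine (mfderiv_verticalLift ((contMDiff_pairing φ).mdifferentiable (by simp) p) _).trans ?_
    have : (fun t : ℝ => (φ p.proj (p.2 + t • -(A p.proj p.2)) : ℝ)) =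
        fun t : ℝ => (φ p.proj p.2 : ℝ) + t * -(φ p.proj (A p.proj p.2) : ℝ) := by
      funext t
      rw [map_add, map_smul, map_neg]
      rfl
    refine (congrArg (fun f : ℝ → ℝ => deriv f 0) this).trans ?_
    rw [deriv_const_add, deriv_mul_const differentiableAt_id]
    simp

variable (EB F E) in
/-- Restriction of a vector field on the total space to a field along the fibre `E x`. -/
def restrictToFibre (x : B) :
    VectorFields EB F E →ₗ[ℝ] (∀ e : E x, TangentSpace IE (⟨x, e⟩ : TotalSpace F E)) where
  toFun X e := X ⟨x, e⟩
  map_add' _ _ := rfl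
  map_smul' _ _ := rfl

variable (EB F E) in
/-- The fibre over `x` of the vector bundle `gl(E)` with `Γ(gl(E)) = 𝔛_lin(E)`: its elements are the
restrictions to `E x` of the fields in `𝔛_lin(E)`.  (A field in `𝔛_lin(E)` vanishes along `E x` exactly
when it lies in `I_x · 𝔛_lin(E)`, where `I_x` is the ideal of functions on `B` vanishing at `x`.) -/
abbrev GlFibre (x : B) : Submodule ℝ (∀ e : E x, TangentSpace IE (⟨x, e⟩ : TotalSpace F E)) :=
  (linearFields EB F E).map (restrictToFibre EB F E x)

/-- The section of `π* gl(E)` pulled back from the section `X ∈ 𝔛_lin(E)` of `gl(E)`. -/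
def pullbackLinear (X : linearFields EB F E) (p : TotalSpace F E) : GlFibre EB F E p.proj :=
  ⟨restrictToFibre EB F E p.proj X, Submodule.mem_map_of_mem X.2⟩

variable (EB F E) in
/-- The `C^∞(E)`-module `Γ(π* gl(E))`: families `σ p ∈ gl(E)_{π p}` that are locally
`C^∞(E)`-linear combinations of pullbacks of sections of `gl(E)`. -/
def glSections : Submodule (TotalFunctions EB F E)
    (∀ p : TotalSpace F E, GlFibre EB F E p.proj) where
  carrier := {σ | ∀ p₀, ∃ τ ∈ Submodule.span (TotalFunctions EB F E)
    (Set.range (pullbackLinear (EB := EB) (F := F) (E := E))), ∀ᶠ p in 𝓝 p₀, σ p = τ p}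
  zero_mem' p₀ := ⟨0, Submodule.zero_mem _, Eventually.of_forall fun _ => rfl⟩
  add_mem' := by
    intro σ σ' h h' p₀
    obtain ⟨τ, hτ, hp⟩ := h p₀
    obtain ⟨τ', hτ', hp'⟩ := h' p₀
    refine ⟨τ + τ', Submodule.add_mem _ hτ hτ', ?_⟩
    filter_upwards [hp, hp'] with p h1 h2
    simp [h1, h2]
  smul_mem' := by
    intro f σ h p₀
    obtain ⟨τ, hτ, hp⟩ := h p₀
    refine ⟨f • τ, Submodule.smul_mem _ f hτ, ?_⟩
    filter_upwards [hp] with p h1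
    simp [family_smul_apply, h1]


variable [FiniteDimensional ℝ EB] [T2Space B]

theorem exists_bump (x₀ : B) {U : Set B} (hU : U ∈ 𝓝 x₀) :
    ∃ χ : C^∞⟮𝓘(ℝ, EB), B; ℝ⟯, (∀ᶠ x in 𝓝 x₀, χ x = 1) ∧ tsupport χ ⊆ U := by
  obtain ⟨f, -, hf⟩ := (SmoothBumpFunction.nhds_basis_tsupport (I := 𝓘(ℝ, EB)) x₀).mem_iff.1 hU
  exact ⟨⟨f, f.contMDiff⟩, f.eventuallyEq_one, hf⟩

section Extension
variable {G : Type*} [NormedAddCommGroup G] [NormedSpace ℝ G] {V : B → Type*}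
  [TopologicalSpace (TotalSpace G V)] [∀ x, AddCommGroup (V x)] [∀ x, Module ℝ (V x)]
  [∀ x, TopologicalSpace (V x)] [FiberBundle G V] [VectorBundle ℝ G V]
  [ContMDiffVectorBundle ∞ G V 𝓘(ℝ, EB)]

theorem exists_section (x₀ : B) (g : G) :
    ∃ s : Cₛ^∞⟮𝓘(ℝ, EB); G, V⟯,
      ∀ᶠ x in 𝓝 x₀, (trivializationAt G V x₀ ⟨x, s x⟩).2 = g := by
  set e := trivializationAt G V x₀ with he
  have hU : e.baseSet ∈ 𝓝 x₀ :=
    e.open_baseSet.mem_nhds (FiberBundle.mem_baseSet_trivializationAt' x₀)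
  obtain ⟨χ, h1, hχ⟩ := exists_bump (EB := EB) x₀ hU
  have hs : ContMDiffOn 𝓘(ℝ, EB) (𝓘(ℝ, EB).prod 𝓘(ℝ, G)) ∞
      (fun x => (⟨x, e.symm x g⟩ : TotalSpace G V)) e.baseSet := by
    rw [e.contMDiffOn_section_baseSet_iff]
    refine (contMDiffOn_const (c := g)).congr fun x hx => ?_
    rw [e.apply_mk_symm hx]
  refine ⟨⟨_, ContMDiffOn.smul_section_of_tsupport (ψ := χ) χ.contMDiff.contMDiffOn
    e.open_baseSet hχ hs⟩, ?_⟩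
  filter_upwards [h1, hU] with x hx hx'
  change (e ⟨x, χ x • e.symm x g⟩).2 = g
  rw [hx, one_smul, e.apply_mk_symm hx']

end Extension

theorem hasMFDerivAt_triv (p : TotalSpace F E) :
    HasMFDerivAt IE IE (trivializationAt F E p.proj : TotalSpace F E → B × F) p
      (ContinuousLinearMap.id ℝ (EB × F)) := by
  have hp : p ∈ (trivializationAt F E p.proj).source :=
    FiberBundle.mem_trivializationAt_proj_source
  have hs : (trivializationAt F E p.proj).source ∈ 𝓝 p :=
    (trivializationAt F E p.proj).open_source.mem_nhds hp
  refine ⟨((trivializationAt F E p.proj).contMDiffOn (IB := 𝓘(ℝ, EB)) (n := ∞)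
    |>.contMDiffAt hs).continuousAt, ?_⟩
  refine (hasFDerivWithinAt_id (𝕜 := ℝ) (extChartAt IE p p) (Set.range IE)).congr_of_eventuallyEq
    ?_ ?_
  · have := extChartAt_target_mem_nhdsWithin (I := IE) p
    filter_upwards [this] with y hy
    exact FiberBundle.writtenInExtChartAt_trivializationAt hy
  · exact FiberBundle.writtenInExtChartAt_trivializationAt (mem_extChartAt_target p)

theorem mfderiv_zeroSection (x : B) (v : EB) :
    mfderiv 𝓘(ℝ, EB) IE (zeroSection F E) x v = (v, (0 : F)) := by
  have h1 := hasMFDerivAt_triv (EB := EB) (zeroSection F E x)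
  have h2 := (contMDiff_zeroSection (IB := 𝓘(ℝ, EB)) (F := F) (n := ∞) ℝ E).mdifferentiable
    (by simp) x
  have h3 := (h1.comp x h2.hasMFDerivAt).mfderiv
  have hx : (trivializationAt F E x).baseSet ∈ 𝓝 x :=
    (trivializationAt F E x).open_baseSet.mem_nhds (FiberBundle.mem_baseSet_trivializationAt' x)
  have h4 : (trivializationAt F E x : TotalSpace F E → B × F) ∘ zeroSection F E =ᶠ[𝓝 x]
      fun y => (y, (0 : F)) := by
    filter_upwards [hx] with y hy
    exact (trivializationAt F E x).zeroSection ℝ hy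
  have h5 := h4.mfderiv_eq (I := 𝓘(ℝ, EB)) (I' := IE)
  have h6 := ((hasMFDerivAt_id (I := 𝓘(ℝ, EB)) x).prodMk
    (hasMFDerivAt_const (I := 𝓘(ℝ, EB)) (I' := 𝓘(ℝ, F)) (0 : F) x)).mfderiv
  have h7 := h3.symm.trans (h5.trans h6)
  exact congrArg (fun A : EB →L[ℝ] EB × F => A v) h7

theorem linear_tangent_zero {X : VectorFields EB F E} (hX : X ∈ linearFields EB F E) (x : B) :
    ∃ v : TangentSpace 𝓘(ℝ, EB) x,
      mfderiv 𝓘(ℝ, EB) IE (zeroSection F E) x v = X (zeroSection F E x) := by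
  let w : EB × F := X (zeroSection F E x)
  suffices hw : w.2 = 0 from
    ⟨w.1, (mfderiv_zeroSection x w.1).trans (Prod.ext rfl hw.symm)⟩
  refine SeparatingDual.eq_zero_of_forall_dual_eq_zero (R := ℝ) fun l => ?_
  obtain ⟨φ, hφ⟩ := exists_section (EB := EB) (G := F →L[ℝ] ℝ)
    (V := fun x : B => E x →L[ℝ] Bundle.Trivial B ℝ x) x l
  obtain ⟨ψ, hψ⟩ := hX.2 φ
  have h0 := hψ (zeroSection F E x)
  have h1 := hasMFDerivAt_triv (EB := EB) (zeroSection F E x)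
  have h2 : HasMFDerivAt IE 𝓘(ℝ, ℝ) (fun z : B × F => l z.2)
      (trivializationAt F E x (zeroSection F E x)) (l.comp (ContinuousLinearMap.snd ℝ EB F)) :=
    (l.hasMFDerivAt (x := (trivializationAt F E x (zeroSection F E x)).2)).comp _
      (hasMFDerivAt_snd (I := 𝓘(ℝ, EB)) (I' := 𝓘(ℝ, F)) _)
  have h3 := (h2.comp _ h1).mfderiv
  have hx : (trivializationAt F E x).baseSet ∈ 𝓝 x :=
    (trivializationAt F E x).open_baseSet.mem_nhds (FiberBundle.mem_baseSet_trivializationAt' x)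
  have h4 : (fun q : TotalSpace F E => (φ q.proj q.2 : ℝ)) =ᶠ[𝓝 (zeroSection F E x)]
      (fun z : B × F => l z.2) ∘ (trivializationAt F E x : TotalSpace F E → B × F) := by
    have hc := (FiberBundle.continuous_proj F E).continuousAt (x := zeroSection F E x)
    filter_upwards [hc.eventually hφ, hc.preimage_mem_nhds hx] with q hq hq'
    have : l = ContinuousLinearMap.inCoordinates F E ℝ (Bundle.Trivial B ℝ) x q.proj x q.proj
      (φ q.proj) := hq.symm
    have hq'' : q.proj ∈ (trivializationAt F E x).baseSet := hq'
    have hq3 : (trivializationAt F E x).symm q.proj (trivializationAt F E x q).2 = q.2 :=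
      (trivializationAt F E x).symm_apply_apply_mk hq'' q.2
    simp only [Function.comp]
    rw [this]
    simp [ContinuousLinearMap.inCoordinates, hq'']
  have h5 := h4.mfderiv_eq (I := IE) (I' := 𝓘(ℝ, ℝ))
  have h6 := congrArg (fun A : EB × F →L[ℝ] ℝ => A w) (h5.trans h3)
  have h7 : (ψ x (0 : E x) : ℝ) = 0 := map_zero _
  exact h6.symm.trans (h0.trans h7)

variable (EB F E) in
/-- The foliation `F_B(E)`: the vector fields on the total space which are tangent to the zero section
along the zero section. -/
def tangentFields : Submodule (TotalFunctions EB F E) (VectorFields EB F E) where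
  carrier := {X | ∀ x : B, ∃ v : TangentSpace 𝓘(ℝ, EB) x,
    mfderiv 𝓘(ℝ, EB) IE (zeroSection F E) x v = X (zeroSection F E x)}
  zero_mem' x := ⟨0, map_zero _⟩
  add_mem' := by
    intro X Y hX hY x
    obtain ⟨v, hv⟩ := hX x
    obtain ⟨w, hw⟩ := hY x
    exact ⟨v + w, (map_add _ _ _).trans (congrArg₂ (· + ·) hv hw)⟩
  smul_mem' := by
    intro f X hX x
    obtain ⟨v, hv⟩ := hX x
    exact ⟨f (zeroSection F E x) • v, (map_smul _ _ _).trans (congrArg (_ • ·) hv)⟩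

theorem evaluate_span {τ : ∀ p : TotalSpace F E, GlFibre EB F E p.proj}
    (hτ : τ ∈ Submodule.span (TotalFunctions EB F E)
      (Set.range (pullbackLinear (EB := EB) (F := F) (E := E)))) :
    ∃ X : VectorFields EB F E, ∀ p, X p = (τ p).1 p.2 := by
  induction hτ using Submodule.span_induction with
  | mem τ h => obtain ⟨X, rfl⟩ := h; exact ⟨X, fun p => rfl⟩
  | zero => exact ⟨0, fun p => rfl⟩
  | add τ τ' _ _ h h' =>
    obtain ⟨X, hX⟩ := h
    obtain ⟨Y, hY⟩ := h'
    exact ⟨X + Y, fun p => congrArg₂ (· + ·) (hX p) (hY p)⟩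
  | smul f τ _ h =>
    obtain ⟨X, hX⟩ := h
    exact ⟨f • X, fun p => congrArg (f p • ·) (hX p)⟩

theorem contMDiff_evaluate {σ : ∀ p : TotalSpace F E, GlFibre EB F E p.proj}
    (hσ : σ ∈ glSections EB F E) :
    ContMDiff IE (ModelWithCorners.prod IE 𝓘(ℝ, EB × F)) ∞
      (fun p => (⟨p, (σ p).1 p.2⟩ :
        TotalSpace (EB × F) (TangentSpace IE : TotalSpace F E → Type _))) := by
  intro p₀
  obtain ⟨τ, hτ, hp⟩ := hσ p₀
  obtain ⟨X, hX⟩ := evaluate_span hτ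
  refine (X.contMDiff p₀).congr_of_eventuallyEq ?_
  filter_upwards [hp] with p h
  rw [h, hX]

variable (EB F E) in
/-- The multiplication map `m : Γ(π* gl(E)) → F_B(E)`, which sends `f ⊗ X` to `f X`: it evaluates `σ p`,
a field along the fibre through `p`, at the point `p`. -/
def anchor : glSections EB F E →ₗ[TotalFunctions EB F E] tangentFields EB F E where
  toFun σ := ⟨⟨fun p => (σ.1 p).1 p.2, contMDiff_evaluate σ.2⟩, fun x => by
    obtain ⟨X, hX, h⟩ := (σ.1 (zeroSection F E x)).2
    obtain ⟨v, hv⟩ := linear_tangent_zero hX x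
    exact ⟨v, hv.trans (congrFun h (0 : E x))⟩⟩
  map_add' _ _ := rfl
  map_smul' _ _ := rfl

variable (EB F E) in
/-- The module `Γ(π*(⋀ᵏE* ⊗ E))`, where `⋀ᵏE* ⊗ E` is the bundle of alternating `k`-linear maps from `E`
to `E`. -/
abbrev AltSections (k : ℕ) : Submodule (TotalFunctions EB F E)
    (∀ p : TotalSpace F E, E p.proj [⋀^Fin k]→L[ℝ] E p.proj) :=
  pullbackSections EB F E (F [⋀^Fin k]→L[ℝ] F) (fun x : B => E x [⋀^Fin k]→L[ℝ] E x)

theorem contract_mem {k : ℕ} {α : ∀ p : TotalSpace F E, E p.proj [⋀^Fin (k + 1)]→L[ℝ] E p.proj}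
    (hα : α ∈ AltSections EB F E (k + 1)) :
    (fun p => interior p.2 (α p)) ∈ AltSections EB F E k := by
  intro p₀
  have h1 := (contMDiffAt_totalSpace.1 (contMDiff_id (I := IE) (n := ∞) p₀)).2
  have h2 := contMDiffAt_totalSpace.1 (hα p₀)
  refine contMDiffAt_totalSpace.2 ⟨h2.1, ?_⟩
  have h3 := ((contDiff_curryLeft (F := F) k).contMDiff _).comp p₀ (h2.2.prodMk_space h1)
  refine h3.congr_of_eventuallyEq ?_
  filter_upwards [(FiberBundle.continuous_proj F E).continuousAt.preimage_mem_nhds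
      ((trivializationAt F E p₀.proj).open_baseSet.mem_nhds
        (FiberBundle.mem_baseSet_trivializationAt' p₀.proj))] with p hp
  have hp' : p.proj ∈ (trivializationAt F E p₀.proj).baseSet := hp
  have hy : (trivializationAt F E p₀.proj).symm p.proj (trivializationAt F E p₀.proj p).2 = p.2 :=
    (trivializationAt F E p₀.proj).symm_apply_apply_mk hp' p.2
  change ContinuousAlternatingMap.inCoordinates F F p₀.proj p.proj p₀.proj p.proj
      (interior p.2 (α p)) =
    (ContinuousAlternatingMap.inCoordinates F F p₀.proj p.proj p₀.proj p.proj (α p)).curryLeft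
      (trivializationAt F E p₀.proj p).2
  ext w
  refine congrArg ((trivializationAt F E p₀.proj).continuousLinearMapAt ℝ p.proj) ?_
  refine congrArg (α p) (funext fun i => ?_)
  refine Fin.cases ?_ (fun j => ?_) i
  · exact hy.symm.trans (Trivialization.symmL_apply _ hp' _).symm
  · rfl

variable (EB F E) in
/-- The differential `Γ(π*(⋀ᵏ⁺¹E* ⊗ E)) → Γ(π*(⋀ᵏE* ⊗ E))`: contraction with the tautological section
`p ↦ p` of `π*E`. -/
def contraction (k : ℕ) : AltSections EB F E (k + 1) →ₗ[TotalFunctions EB F E]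
    AltSections EB F E k where
  toFun α := ⟨fun p => interior p.2 (α.1 p), contract_mem α.2⟩
  map_add' _ _ := rfl
  map_smul' _ _ := rfl

section EndInclusion
variable [FiniteDimensional ℝ F]

/-- The identification `⋀¹E* ⊗ E = End E`, on a fibre. -/
def linearOfAlt {x : B} (α : E x [⋀^Fin 1]→L[ℝ] E x) : E x →L[ℝ] E x :=
  (ContinuousAlternatingMap.ofSubsingleton ℝ (E x) (E x) (0 : Fin 1)).symm α

theorem trivialization_inj {x : B} {G : Type*} [NormedAddCommGroup G] [NormedSpace ℝ G]
    {V : B → Type*} [TopologicalSpace (TotalSpace G V)] [∀ x, AddCommGroup (V x)]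
    [∀ x, Module ℝ (V x)] [∀ x, TopologicalSpace (V x)] [FiberBundle G V] [VectorBundle ℝ G V]
    {e : Trivialization G (TotalSpace.proj : TotalSpace G V → B)} (hx : x ∈ e.baseSet) {v w : V x}
    (h : (e ⟨x, v⟩).2 = (e ⟨x, w⟩).2) : v = w := by
  rw [← e.symm_apply_apply_mk hx v, ← e.symm_apply_apply_mk hx w, h]

theorem vertical_mem {x : B} (A : E x →L[ℝ] E x) :
    (fun e : E x => (verticalLift EB (⟨x, e⟩ : TotalSpace F E) (-(A e)) :
      TangentSpace IE (⟨x, e⟩ : TotalSpace F E))) ∈ GlFibre EB F E x := by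
  obtain ⟨s, hs⟩ := exists_section (EB := EB) (V := fun x : B => E x →L[ℝ] E x) x
    (trivializationAt (F →L[ℝ] F) (fun x : B => E x →L[ℝ] E x) x ⟨x, A⟩).2
  have hA : s x = A :=
    trivialization_inj (FiberBundle.mem_baseSet_trivializationAt' x) hs.self_of_nhds
  exact ⟨endField s, endField_mem s, by subst hA; rfl⟩

variable (EB F E) in
/-- The inclusion `End(E)_x → gl(E)_x` induced by `a : Γ(End E) → 𝔛_lin(E)`. -/
def endFibre (x : B) : (E x →L[ℝ] E x) →ₗ[ℝ] GlFibre EB F E x where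
  toFun A := ⟨fun e => verticalLift EB (⟨x, e⟩ : TotalSpace F E) (-(A e)), vertical_mem A⟩
  map_add' A A' := by
    refine Subtype.ext (funext fun e => ?_)
    refine (congrArg (verticalLift EB (⟨x, e⟩ : TotalSpace F E)) ?_).trans
      (verticalLift_add (EB := EB) ⟨x, e⟩ (-(A e)) (-(A' e)))
    exact neg_add _ _
  map_smul' c A := by
    refine Subtype.ext (funext fun e => ?_)
    refine (congrArg (verticalLift EB (⟨x, e⟩ : TotalSpace F E)) ?_).trans
      (verticalLift_smul (EB := EB) ⟨x, e⟩ c (-(A e)))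
    exact (smul_neg _ _).symm

theorem linearOfAlt_mem {α : ∀ p : TotalSpace F E, E p.proj [⋀^Fin 1]→L[ℝ] E p.proj}
    (hα : α ∈ AltSections EB F E 1) :
    (fun p => linearOfAlt (α p)) ∈
      pullbackSections EB F E (F →L[ℝ] F) (fun x : B => E x →L[ℝ] E x) := by
  intro p₀
  have h2 := contMDiffAt_totalSpace.1 (hα p₀)
  refine contMDiffAt_totalSpace.2 ⟨h2.1, ?_⟩
  have h3 : ContMDiffAt IE 𝓘(ℝ, F →L[ℝ] F) ∞ _ p₀ :=
    ((ContinuousAlternatingMap.ofSubsingletonLIE (𝕜 := ℝ) (E := F) (F := F) (0 : Fin 1)).symm.toContinuousLinearEquiv.toContinuousLinearMap.contMDiff _).comp p₀ h2.2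
  exact h3

theorem endInclusion_mem {α : ∀ p : TotalSpace F E, E p.proj [⋀^Fin 1]→L[ℝ] E p.proj}
    (hα : α ∈ AltSections EB F E 1) :
    (fun p : TotalSpace F E => endFibre EB F E p.proj (linearOfAlt (α p))) ∈
      glSections EB F E := by
  intro p₀
  set V := fun x : B => E x →L[ℝ] E x with hV
  set x₀ := p₀.proj with hx₀
  set e := trivializationAt (F →L[ℝ] F) V x₀ with he
  have hU : e.baseSet ∈ 𝓝 x₀ :=
    e.open_baseSet.mem_nhds (FiberBundle.mem_baseSet_trivializationAt' x₀)
  obtain ⟨χ, h1, hχ⟩ := exists_bump (EB := EB) x₀ hU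
  let b := Module.finBasis ℝ (F →L[ℝ] F)
  choose s hs using fun i => exists_section (EB := EB) (V := V) x₀ (b i)
  have hc : ContMDiffOn IE 𝓘(ℝ, F →L[ℝ] F) ∞
      (fun p : TotalSpace F E => (e ⟨p.proj, linearOfAlt (α p)⟩).2)
      (TotalSpace.proj ⁻¹' e.baseSet) := by
    have := (linearOfAlt_mem hα : ContMDiff _ _ _ _).contMDiffOn
      (s := (TotalSpace.proj ⁻¹' e.baseSet))
    exact ((e.contMDiffOn_iff (fun p hp => e.mem_source.2 hp)).1 this).2
  have hopen : IsOpen (TotalSpace.proj ⁻¹' e.baseSet : Set (TotalSpace F E)) :=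
    e.open_baseSet.preimage (FiberBundle.continuous_proj F E)
  let f : Fin (Module.finrank ℝ (F →L[ℝ] F)) → TotalSpace F E → ℝ := fun i p =>
    χ p.proj * b.coord i (e ⟨p.proj, linearOfAlt (α p)⟩).2
  have hf : ∀ i, ContMDiff IE 𝓘(ℝ, ℝ) ∞ (f i) := by
    intro i
    refine contMDiff_of_tsupport fun p hp => ?_
    have hp' : p ∈ (TotalSpace.proj ⁻¹' e.baseSet : Set (TotalSpace F E)) := by
      apply hχ
      have hsub : tsupport (f i) ⊆ TotalSpace.proj ⁻¹' (tsupport χ) := by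
        refine closure_minimal (fun q hq => subset_closure ?_)
          ((isClosed_tsupport _).preimage (FiberBundle.continuous_proj F E))
        exact left_ne_zero_of_mul hq
      exact hsub hp
    refine ContMDiffAt.mul ((χ.contMDiff.comp (contMDiff_proj E)) p) ?_
    exact ((LinearMap.toContinuousLinearMap (b.coord i)).contMDiff _).comp p
      (hc.contMDiffAt (hopen.mem_nhds hp'))
  let g : Fin (Module.finrank ℝ (F →L[ℝ] F)) → TotalFunctions EB F E := fun i => ⟨f i, hf i⟩
  refine ⟨∑ i, g i • pullbackLinear ⟨endField (s i), endField_mem (s i)⟩,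
    Submodule.sum_mem _ fun i _ => Submodule.smul_mem _ _
      (Submodule.subset_span (Set.mem_range_self _)), ?_⟩
  have hcont := (FiberBundle.continuous_proj F E).continuousAt (x := p₀)
  have hp₀U : p₀ ∈ (TotalSpace.proj ⁻¹' e.baseSet : Set (TotalSpace F E)) :=
    (mem_of_mem_nhds hU : x₀ ∈ e.baseSet)
  filter_upwards [hcont.eventually h1, hcont.eventually (eventually_all.2 hs),
    hopen.mem_nhds hp₀U] with p hp1 hps hpU
  have hpU' : p.proj ∈ e.baseSet := hpU
  have hsum : linearOfAlt (α p) = ∑ i, f i p • s i p.proj := by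
    apply trivialization_inj hpU'
    have hlin : ∀ A, (e ⟨p.proj, A⟩).2 = e.linearEquivAt ℝ p.proj hpU' A := fun A => rfl
    rw [hlin (∑ i, f i p • s i p.proj), map_sum]
    have : ∀ i, e.linearEquivAt ℝ p.proj hpU' (f i p • s i p.proj) =
        b.repr (e ⟨p.proj, linearOfAlt (α p)⟩).2 i • b i := by
      intro i
      rw [map_smul, ← hlin, hps i]
      simp [f, hp1]
    rw [Finset.sum_congr rfl fun i _ => this i, b.sum_repr]
  rw [hsum, map_sum, Finset.sum_apply]
  refine Finset.sum_congr rfl fun i _ => ?_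
  rw [map_smul]
  rfl

variable (EB F E) in
/-- The inclusion `Γ(π*(E* ⊗ E)) = Γ(π* End E) → Γ(π* gl(E))` induced by `a`. -/
def endInclusion : AltSections EB F E 1 →ₗ[TotalFunctions EB F E] glSections EB F E where
  toFun α := ⟨fun p => endFibre EB F E p.proj (linearOfAlt (α.1 p)), endInclusion_mem α.2⟩
  map_add' α β := Subtype.ext (funext fun p =>
    map_add (endFibre EB F E p.proj) (linearOfAlt (α.1 p)) (linearOfAlt (β.1 p)))
  map_smul' f α := Subtype.ext (funext fun p =>
    map_smul (endFibre EB F E p.proj) (f p) (linearOfAlt (α.1 p)))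

end EndInclusion
end Bundle
end ZeroSectionFoliation

end

open ZeroSectionFoliation

noncomputable section

set_option linter.unusedSectionVars false

/-! Every map of the complex is given pointwise over `E`. A partition of unity on the base therefore
reduces the solution of each equation to a chart with coordinates `(u, y)`, where `u` ranges over an
open set of the base and `y` over all of `F` (`exists_solution_of_local`).

The terms `⋀ᵏE* ⊗ E` form the Koszul complex of the tautological section `y`. If `a(u, y)` is a form
of degree `k + 1 ≥ 1` with `ι_y a = 0`, Cartan's formula for the Euler field along the fibre reads
`ι_y da = D_y a(y) + (k + 1) a`, so that `d/dt (t^(k+1) a(u, ty)) = t^(k+1) ι_y (da)(u, ty)`.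
Integration from 0 to 1 gives `a = ι_y b` with `b = ∫ t^(k+1) (da)(u, ty) dt`, which is smooth in
all variables (`exists_contDiffOn_curryLeft_eq`, `exact_contraction`).

For surjectivity of `m`, tangency to the zero section means that the fibre component of `X` vanishes
at `y = 0`. By Hadamard's lemma it equals `C(u, y) y`, so `X` is locally a combination, with
coefficients in `C^∞(E)`, of the fields `(v, C y)` with constant `v` and `C`. Cut off by functions
of the base, these lie in `𝔛_lin(E)` (`exists_linearField`, `anchor_surjective`).

If `m σ = 0`, then for each `p` the element `σ p` is the restriction to the fibre of a linear field
vanishing at the point `p`. The base component of a linear field is constant along a fibre, so it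
vanishes on the whole fibre. What remains is vertical and linear, that is, an endomorphism `A p`
(`exists_endFibre_of_eval_eq_zero`). It depends smoothly on `p`, as is seen by pairing with sections
of `E*` (`mem_pullbackSections_of_endFibre`). Hence `σ` comes from a section `α` of `π* End E`, and
`m σ = 0` becomes `α p p = 0`, the Koszul cycle condition in degree one. Exactness there gives `α =
d₂ β`. -/

namespace ZeroSectionFoliation

/-! ### Smooth dependence of integrals on parameters. -/

section Calculus
variable {P G : Type*} [NormedAddCommGroup P] [NormedSpace ℝ P] [FiniteDimensional ℝ P]
  [NormedAddCommGroup G] [NormedSpace ℝ G]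

/-- Differentiation under the integral sign by domination: the partial derivative is bounded on the
product of a closed ball with `[0, 1]`, which is compact because `P` has finite dimension. -/
theorem hasFDerivAt_intervalIntegral_of_contDiffOn {f : P × ℝ → G} {U : Set P} (hU : IsOpen U)
    (hf : ContDiffOn ℝ 1 f (U ×ˢ Set.univ)) {x : P} (hx : x ∈ U) :
    HasFDerivAt (fun x => ∫ t in (0 : ℝ)..1, f (x, t))
      (∫ t in (0 : ℝ)..1, (fderiv ℝ f (x, t)).comp (ContinuousLinearMap.inl ℝ P ℝ)) x := by
  have hUo : IsOpen (U ×ˢ (Set.univ : Set ℝ)) := hU.prod isOpen_univ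
  obtain ⟨r, hr, hrU⟩ := Metric.nhds_basis_closedBall.mem_iff.1 (hU.mem_nhds hx)
  have hc : ∀ y ∈ U, Continuous fun t : ℝ => f (y, t) := fun y hy =>
    hf.continuousOn.comp_continuous (by fun_prop) fun t => ⟨hy, trivial⟩
  have hd : ContinuousOn (fun z : P × ℝ => (fderiv ℝ f z).comp (ContinuousLinearMap.inl ℝ P ℝ))
      (U ×ˢ Set.univ) :=
    (hf.continuousOn_fderiv_of_isOpen hUo (by simp)).clm_comp continuousOn_const
  have hK : IsCompact (Metric.closedBall x r ×ˢ Set.Icc (0 : ℝ) 1) :=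
    (isCompact_closedBall x r).prod isCompact_Icc
  obtain ⟨C, hC⟩ := hK.exists_bound_of_continuousOn
    (hd.mono (Set.prod_mono hrU (Set.subset_univ _)))
  refine intervalIntegral.hasFDerivAt_integral_of_dominated_of_fderiv_le (𝕜 := ℝ)
    (F := fun x t => f (x, t)) (bound := fun _ => C)
    (F' := fun x t => (fderiv ℝ f (x, t)).comp (ContinuousLinearMap.inl ℝ P ℝ))
    (Metric.closedBall_mem_nhds x hr) ?_ ((hc x hx).intervalIntegrable _ _) ?_ ?_
    intervalIntegrable_const ?_
  · filter_upwards [hU.mem_nhds hx] with y hy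
    exact (hc y hy).aestronglyMeasurable
  · exact (hd.comp_continuous (by fun_prop : Continuous fun t : ℝ => (x, t))
      fun t => ⟨hx, trivial⟩).aestronglyMeasurable
  · refine Eventually.of_forall fun t ht y hy => hC (y, t) ⟨hy, ?_⟩
    rw [Set.uIoc_of_le zero_le_one] at ht
    exact ⟨ht.1.le, ht.2⟩
  · refine Eventually.of_forall fun t ht y hy => ?_
    have h1 : HasFDerivAt f (fderiv ℝ f (y, t)) (y, t) :=
      ((hf.differentiableOn (by simp)).differentiableAt
        (hUo.mem_nhds ⟨hrU hy, trivial⟩)).hasFDerivAt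
    have h2 : HasFDerivAt (fun y : P => (y, t)) (ContinuousLinearMap.inl ℝ P ℝ) y :=
      hasFDerivAt_prodMk_left y t
    exact h1.comp y h2

theorem contDiffOn_intervalIntegral {f : P × ℝ → G} {U : Set P} (hU : IsOpen U)
    (hf : ContDiffOn ℝ ∞ f (U ×ˢ Set.univ)) :
    ContDiffOn ℝ ∞ (fun x => ∫ t in (0 : ℝ)..1, f (x, t)) U := by
  have hUo : IsOpen (U ×ˢ (Set.univ : Set ℝ)) := hU.prod isOpen_univ
  refine contDiffOn_infty.2 fun n => ?_
  induction n generalizing f with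
  | zero =>
    refine contDiffOn_zero.2 fun x hx => ?_
    exact (hasFDerivAt_intervalIntegral_of_contDiffOn hU
      (hf.of_le (by exact_mod_cast le_top)) hx).continuousAt.continuousWithinAt
  | succ n ih =>
    have h1 := fun x hx => hasFDerivAt_intervalIntegral_of_contDiffOn hU
      (hf.of_le (by exact_mod_cast le_top)) (x := x) hx
    rw [Nat.cast_add, Nat.cast_one]
    -- Testing the derivative on a fixed vector `v` gives an integral of a smooth function with
    -- values in the same space `G`, to which the induction hypothesis applies.
    refine contDiffOn_succ_of_fderiv_apply
      (fun x hx => (h1 x hx).differentiableAt.differentiableWithinAt)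
      (fun h => (WithTop.natCast_ne_top n h).elim) fun v => ?_
    have hf' : ContDiffOn ℝ ∞ (fderiv ℝ f) (U ×ˢ Set.univ) :=
      ((contDiffOn_infty_iff_fderiv_of_isOpen hUo).1 hf).2
    refine (ih (f := fun z => fderiv ℝ f z (v, 0)) (hf'.clm_apply contDiffOn_const)).congr
      fun x hx => ?_
    rw [fderivWithin_of_isOpen hU hx, (h1 x hx).fderiv,
      ContinuousLinearMap.intervalIntegral_apply]
    · simp
    · refine (Continuous.intervalIntegrable ?_ _ _)
      exact (hf'.continuousOn.comp_continuous (by fun_prop : Continuous fun t : ℝ => (x, t))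
        fun t => ⟨hx, trivial⟩).clm_comp continuous_const

end Calculus

/-! ### Hadamard's lemma with parameters. -/

section Radial
variable {P F G : Type*} [NormedAddCommGroup P] [NormedSpace ℝ P] [FiniteDimensional ℝ P]
  [NormedAddCommGroup F] [NormedSpace ℝ F] [FiniteDimensional ℝ F]
  [NormedAddCommGroup G] [NormedSpace ℝ G]

omit [FiniteDimensional ℝ P] [FiniteDimensional ℝ F] in
theorem hasFDerivAt_comp_prodMk_right {f : P × F → G} {u : P} {y : F} (hf : DifferentiableAt ℝ f (u, y)) :
    HasFDerivAt (fun y => f (u, y))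
      ((fderiv ℝ f (u, y)).comp (ContinuousLinearMap.inr ℝ P F)) y :=
  hf.hasFDerivAt.comp y (hasFDerivAt_prodMk_right u y)

/-- Hadamard's lemma with parameters: a smooth function vanishing for `y = 0` is the value at `y` of a
linear map depending smoothly on all variables. -/
theorem exists_contDiffOn_linear_of_zero [CompleteSpace G] {f : P × F → G} {U : Set P}
    (hU : IsOpen U)
    (hf : ContDiffOn ℝ ∞ f (U ×ˢ Set.univ)) (h0 : ∀ u ∈ U, f (u, 0) = 0) :
    ∃ C : P × F → F →L[ℝ] G, ContDiffOn ℝ ∞ C (U ×ˢ Set.univ) ∧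
      ∀ u ∈ U, ∀ y, f (u, y) = C (u, y) y := by
  have hUo : IsOpen (U ×ˢ (Set.univ : Set F)) := hU.prod isOpen_univ
  have hf' : ContDiffOn ℝ ∞ (fderiv ℝ f) (U ×ˢ Set.univ) :=
    ((contDiffOn_infty_iff_fderiv_of_isOpen hUo).1 hf).2
  let D : P × F → F →L[ℝ] G := fun z =>
    (fderiv ℝ f z).comp (ContinuousLinearMap.inr ℝ P F)
  have hD : ContDiffOn ℝ ∞ D (U ×ˢ Set.univ) := hf'.clm_comp contDiffOn_const
  have hDt : ContDiffOn ℝ ∞ (fun z : (P × F) × ℝ => D (z.1.1, z.2 • z.1.2))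
      ((U ×ˢ Set.univ) ×ˢ Set.univ) := by
    refine hD.comp (ContDiff.contDiffOn (by fun_prop)) ?_
    rintro ⟨⟨u, y⟩, t⟩ ⟨⟨hu, -⟩, -⟩
    exact ⟨hu, trivial⟩
  -- The mean of the partial derivative over the segment from `0` to `y`; applied to `y` it is the
  -- integral of `d/dt f(u, ty)`.
  refine ⟨fun z => ∫ t in (0 : ℝ)..1, D (z.1, t • z.2), contDiffOn_intervalIntegral hUo hDt, ?_⟩
  intro u hu y
  have hcont : Continuous fun t : ℝ => D (u, t • y) :=
    hD.continuousOn.comp_continuous (by fun_prop) fun t => ⟨hu, trivial⟩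
  rw [ContinuousLinearMap.intervalIntegral_apply (hcont.intervalIntegrable _ _)]
  have hder : ∀ t : ℝ, HasDerivAt (fun t : ℝ => f (u, t • y)) (D (u, t • y) y) t := by
    intro t
    have h1 := hasFDerivAt_comp_prodMk_right (f := f) (u := u) (y := t • y)
      ((hf.differentiableOn (by simp)).differentiableAt (hUo.mem_nhds ⟨hu, trivial⟩))
    have h2 : HasDerivAt (fun t : ℝ => t • y) y t := by
      simpa using (hasDerivAt_id t).smul_const y
    exact HasFDerivAt.comp_hasDerivAt (f := fun t : ℝ => t • y) t h1 h2
  rw [intervalIntegral.integral_eq_sub_of_hasDerivAt (fun t _ => hder t)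
    ((hcont.clm_apply continuous_const).intervalIntegrable _ _)]
  simp [h0 u hu]

end Radial

/-! ### The Koszul complex on a vector space, contracted radially. -/

section Koszul
variable {P F G : Type*} [NormedAddCommGroup P] [NormedSpace ℝ P]
  [NormedAddCommGroup F] [NormedSpace ℝ F]
  [NormedAddCommGroup G] [NormedSpace ℝ G]

variable (F G) in
/-- Contraction of alternating forms with vectors, as a continuous bilinear map. -/
def curryLeftCLM (k : ℕ) :
    (F [⋀^Fin (k + 1)]→L[ℝ] G) →L[ℝ] (F →L[ℝ] (F [⋀^Fin k]→L[ℝ] G)) :=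
  (ContinuousAlternatingMap.curryLeftLI (𝕜 := ℝ) (E := F) (F := G)
    (n := k)).toContinuousLinearMap

theorem curryLeftCLM_apply (k : ℕ) (a : F [⋀^Fin (k + 1)]→L[ℝ] G) (v : F) (w : Fin k → F) :
    curryLeftCLM F G k a v w = a (Matrix.vecCons v w) := rfl

set_option synthInstance.maxHeartbeats 200000 in
/-- Cartan's formula for the Euler field, applied to a form annihilated by the Euler field. -/
theorem curryLeft_extDeriv_of_curryLeft_eq_zero {k : ℕ} {a : F → F [⋀^Fin (k + 1)]→L[ℝ] G}
    (ha : Differentiable ℝ a) (h0 : ∀ y, curryLeftCLM F G k (a y) y = 0) (y : F) :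
    curryLeftCLM F G (k + 1) (extDeriv a y) y = fderiv ℝ a y y + (k + 1 : ℝ) • a y := by
  -- Differentiating the identity `ι_y a(y) = 0` in the direction `v` trades the derivative of `a`
  -- for `a` itself.
  have key : ∀ v : F, ∀ w : Fin k → F,
      fderiv ℝ a y v (Matrix.vecCons y w) = - a y (Matrix.vecCons v w) := by
    intro v w
    have h1 := HasFDerivAt.comp (f := fun y => (a y, y)) y
      ((curryLeftCLM F G k).isBoundedBilinearMap.hasFDerivAt (a y, y))
      ((ha y).hasFDerivAt.prodMk (hasFDerivAt_id y))
    have h2 : HasFDerivAt ((fun z : (F [⋀^Fin (k + 1)]→L[ℝ] G) × F =>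
        curryLeftCLM F G k z.1 z.2) ∘ fun y => (a y, y))
        (0 : F →L[ℝ] (F [⋀^Fin k]→L[ℝ] G)) y :=
      (hasFDerivAt_const (0 : F [⋀^Fin k]→L[ℝ] G) y).congr_of_eventuallyEq
        (Eventually.of_forall fun z => h0 z)
    have h3 := congrArg (fun T => T w) (congrArg (fun T => T v) (h1.unique h2))
    have h4 : a y (Matrix.vecCons v w) + fderiv ℝ a y v (Matrix.vecCons y w) = 0 := h3
    exact (neg_eq_of_add_eq_zero_right h4).symm
  ext w
  rw [curryLeftCLM_apply, extDeriv, ContinuousAlternatingMap.alternatizeUncurryFin_apply,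
    Fin.sum_univ_succ]
  -- The term with index 0 is the radial derivative. Each of the other `k + 1` terms equals `a y w`:
  -- the sign `(-1)^i` from moving `w i` back into slot `i` and the minus sign of `key` cancel
  -- `(-1)^(i+1)`.
  have hterm : ∀ i : Fin (k + 1), (-1 : ℤ) ^ ((i.succ : Fin (k + 2)) : ℕ) •
      fderiv ℝ a y ((Matrix.vecCons y w : Fin (k + 2) → F) i.succ)
        (i.succ.removeNth (Matrix.vecCons y w)) = a y w := by
    intro i
    have h1 : i.succ.removeNth (Matrix.vecCons y w : Fin (k + 2) → F) =
        Matrix.vecCons y (i.removeNth w) := by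
      funext j
      refine Fin.cases rfl (fun j => ?_) j
      simp [Fin.removeNth_apply]
    have h2 := (a y).map_insertNth i (w i) (i.removeNth w)
    rw [Fin.insertNth_self_removeNth] at h2
    rw [h1, Matrix.cons_val_succ, key, Fin.val_succ, pow_succ, h2]
    simp
  rw [Finset.sum_congr rfl fun i _ => hterm i]
  have h0 : (0 : Fin (k + 2)).removeNth (Matrix.vecCons y w : Fin (k + 2) → F) = w := by
    simp [Matrix.vecCons]
  rw [h0]
  simp
  norm_cast

set_option synthInstance.maxHeartbeats 200000 in
/-- The Koszul complex of the tautological section is exact in positive degrees: an alternating form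
depending smoothly on `(u, y)` and annihilated by contraction with `y` is such a contraction. -/
theorem exists_contDiffOn_curryLeft_eq [FiniteDimensional ℝ P] [FiniteDimensional ℝ F]
    [CompleteSpace G] {k : ℕ} {a : P × F → F [⋀^Fin (k + 1)]→L[ℝ] G} {U : Set P}
    (hU : IsOpen U) (ha : ContDiffOn ℝ ∞ a (U ×ˢ Set.univ))
    (h0 : ∀ u ∈ U, ∀ y, curryLeftCLM F G k (a (u, y)) y = 0) :
    ∃ b : P × F → F [⋀^Fin (k + 2)]→L[ℝ] G, ContDiffOn ℝ ∞ b (U ×ˢ Set.univ) ∧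
      ∀ u ∈ U, ∀ y, curryLeftCLM F G (k + 1) (b (u, y)) y = a (u, y) := by
  have hUo : IsOpen (U ×ˢ (Set.univ : Set F)) := hU.prod isOpen_univ
  have ha' : ContDiffOn ℝ ∞ (fderiv ℝ a) (U ×ˢ Set.univ) :=
    ((contDiffOn_infty_iff_fderiv_of_isOpen hUo).1 ha).2
  let D : P × F → F →L[ℝ] F [⋀^Fin (k + 1)]→L[ℝ] G := fun z =>
    (fderiv ℝ a z).comp (ContinuousLinearMap.inr ℝ P F)
  let e : P × F → F [⋀^Fin (k + 2)]→L[ℝ] G := fun z =>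
    ContinuousAlternatingMap.alternatizeUncurryFinCLM ℝ F G (D z)
  have hD : ContDiffOn ℝ ∞ D (U ×ˢ Set.univ) := ha'.clm_comp contDiffOn_const
  have he : ContDiffOn ℝ ∞ e (U ×ˢ Set.univ) :=
    ContDiff.comp_contDiffOn
      (g := ContinuousAlternatingMap.alternatizeUncurryFinCLM (n := k + 1) ℝ F G)
      (ContinuousLinearMap.contDiff _) hD
  have het : ContDiffOn ℝ ∞ (fun z : (P × F) × ℝ => z.2 ^ (k + 1) • e (z.1.1, z.2 • z.1.2))
      ((U ×ˢ Set.univ) ×ˢ Set.univ) := by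
    have h1 : ContDiff ℝ ∞ (fun z : (P × F) × ℝ => (z.1.1, z.2 • z.1.2)) := by fun_prop
    have h2 : ContDiff ℝ ∞ (fun z : (P × F) × ℝ => z.2 ^ (k + 1)) := by fun_prop
    refine h2.contDiffOn.smul (he.comp h1.contDiffOn ?_)
    rintro ⟨⟨u, y⟩, t⟩ ⟨⟨hu, -⟩, -⟩
    exact ⟨hu, trivial⟩
  -- The exponent is the degree of `a`; with it the contraction of the integrand with `y` is the
  -- exact derivative of `t ^ (k + 1) • a (u, t • y)`.
  refine ⟨fun z => ∫ t in (0 : ℝ)..1, t ^ (k + 1) • e (z.1, t • z.2),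
    contDiffOn_intervalIntegral hUo het, ?_⟩
  intro u hu y
  have hdiff : ∀ y, HasFDerivAt (fun y => a (u, y)) (D (u, y)) y := fun y =>
    hasFDerivAt_comp_prodMk_right
      ((ha.differentiableOn (by simp)).differentiableAt (hUo.mem_nhds ⟨hu, trivial⟩))
  have hcont : Continuous fun t : ℝ => t ^ (k + 1) • e (u, t • y) :=
    (continuous_pow (k + 1)).smul
      (he.continuousOn.comp_continuous (by fun_prop) fun t => ⟨hu, trivial⟩)
  let c : (F [⋀^Fin (k + 2)]→L[ℝ] G) →L[ℝ] (F [⋀^Fin (k + 1)]→L[ℝ] G) :=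
    (curryLeftCLM F G (k + 1)).flip y
  change c (∫ t in (0 : ℝ)..1, t ^ (k + 1) • e (u, t • y)) = _
  rw [← c.intervalIntegral_comp_comm (hcont.intervalIntegrable _ _)]
  have hder : ∀ t : ℝ, HasDerivAt (fun t : ℝ => t ^ (k + 1) • a (u, t • y))
      (c (t ^ (k + 1) • e (u, t • y))) t := by
    intro t
    have h2 : HasDerivAt (fun t : ℝ => t • y) y t := by
      simpa using (hasDerivAt_id t).smul_const y
    have h3 : HasDerivAt (fun t : ℝ => a (u, t • y)) (D (u, t • y) y) t :=
      HasFDerivAt.comp_hasDerivAt (f := fun t : ℝ => t • y) t (hdiff (t • y)) h2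
    have h4 := (hasDerivAt_pow (k + 1) t).smul h3
    refine h4.congr_deriv ?_
    -- Cartan's formula at `t • y`. One factor `t` of the weight is used to turn contraction with
    -- `y` into contraction with `t • y`.
    have h5 := curryLeft_extDeriv_of_curryLeft_eq_zero (a := fun y => a (u, y))
      (fun y => (hdiff y).differentiableAt) (h0 u hu) (t • y)
    rw [extDeriv, (hdiff (t • y)).fderiv] at h5
    have h6 : t • c (e (u, t • y)) = t • D (u, t • y) y + (k + 1 : ℝ) • a (u, t • y) := by
      rw [← map_smul (D (u, t • y)), ← h5]
      exact (map_smul (curryLeftCLM F G (k + 1) (e (u, t • y))) t y).symm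
    have h7 : c (t ^ (k + 1) • e (u, t • y)) = t ^ k • t • c (e (u, t • y)) := by
      rw [map_smul, pow_succ, mul_smul]
    rw [h7, h6, smul_add, smul_smul, smul_smul, ← pow_succ]
    congr 2
    push_cast
    exact mul_comm _ _
  -- The boundary term at `t = 0` vanishes because the exponent `k + 1` is positive; this is where
  -- positive degree enters.
  rw [intervalIntegral.integral_eq_sub_of_hasDerivAt (fun t _ => hder t)
    ((c.continuous.comp hcont).intervalIntegrable _ _)]
  simp

end Koszul

/-! ### The smooth structure on the bundle of alternating forms. -/

section AlternatingBundle
variable {F F' : Type*} [NormedAddCommGroup F] [NormedSpace ℝ F] [FiniteDimensional ℝ F]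
  [NormedAddCommGroup F'] [NormedSpace ℝ F'] [FiniteDimensional ℝ F']

variable (F F') in
/-- An alternating form is determined by its values on the vectors of a basis. -/
def evalBasis (k : ℕ) :
    (F [⋀^Fin k]→L[ℝ] F') →L[ℝ] ((Fin k → Fin (Module.finrank ℝ F)) → F') :=
  ContinuousLinearMap.pi fun i =>
    (ContinuousMultilinearMap.apply ℝ (fun _ : Fin k => F) F'
      (fun j => Module.finBasis ℝ F (i j))).comp
      (ContinuousAlternatingMap.toContinuousMultilinearMapCLM ℝ)

omit [FiniteDimensional ℝ F'] in
theorem evalBasis_injective (k : ℕ) : Function.Injective (evalBasis F F' k) := by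
  intro a b h
  apply ContinuousAlternatingMap.toAlternatingMap_injective
  refine Module.Basis.ext_alternating (Module.finBasis ℝ F) fun v _ => ?_
  exact congrFun h v

instance finiteDimensional_continuousAlternatingMap (k : ℕ) :
    FiniteDimensional ℝ (F [⋀^Fin k]→L[ℝ] F') :=
  Module.Finite.of_injective (evalBasis F F' k).toLinearMap (evalBasis_injective k)

/-- A family of alternating forms is smooth if its values on constant vectors are. -/
theorem contDiff_alternating_of_apply {X : Type*} [NormedAddCommGroup X] [NormedSpace ℝ X] {k : ℕ}
    {f : X → F [⋀^Fin k]→L[ℝ] F'} (hf : ∀ v, ContDiff ℝ ∞ fun x => f x v) : ContDiff ℝ ∞ f := by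
  obtain ⟨l, hl⟩ := (evalBasis F F' k).toLinearMap.exists_leftInverse_of_injective
    (LinearMap.ker_eq_bot.2 (evalBasis_injective k))
  have h1 : ContDiff ℝ ∞ fun x => evalBasis F F' k (f x) := contDiff_pi.2 fun i => hf _
  have h2 := (LinearMap.toContinuousLinearMap l).contDiff.comp h1
  convert h2 using 1
  funext x
  exact (LinearMap.congr_fun hl (f x)).symm

/-- On a fixed form and fixed vectors, `a (g v₁, …, g vₖ)` is polynomial in `g`. Testing on each
form suffices because the space of forms has finite dimension. -/
theorem contDiff_compContinuousLinearMapCLM (k : ℕ) :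
    ContDiff ℝ ∞ (fun g : F →L[ℝ] F =>
      (ContinuousAlternatingMap.compContinuousLinearMapCLM g :
        (F [⋀^Fin k]→L[ℝ] F') →L[ℝ] (F [⋀^Fin k]→L[ℝ] F'))) := by
  refine contDiff_clm_apply_iff.2 fun a => contDiff_alternating_of_apply fun v => ?_
  change ContDiff ℝ ∞ fun g : F →L[ℝ] F => a.toContinuousMultilinearMap fun i => g (v i)
  exact a.toContinuousMultilinearMap.contDiff.comp
    (contDiff_pi.2 fun i => (ContinuousLinearMap.apply ℝ F (v i)).contDiff)

set_option synthInstance.maxHeartbeats 200000 in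
theorem contDiff_compContinuousAlternatingMapCLM (k : ℕ) :
    ContDiff ℝ ∞ (fun g : F →L[ℝ] F =>
      ContinuousLinearMap.compContinuousAlternatingMapCLM (ι := Fin k) ℝ F F F g) := by
  refine contDiff_clm_apply_iff.2 fun a => contDiff_alternating_of_apply fun v => ?_
  exact (ContinuousLinearMap.apply ℝ F (a v)).contDiff

variable {EB : Type*} [NormedAddCommGroup EB] [NormedSpace ℝ EB] {B : Type*} [TopologicalSpace B]
  [ChartedSpace EB B] {E : B → Type*}
  [TopologicalSpace (TotalSpace F E)] [∀ x, AddCommGroup (E x)] [∀ x, Module ℝ (E x)]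
  [∀ x, TopologicalSpace (E x)] [FiberBundle F E] [VectorBundle ℝ F E]
  [ContMDiffVectorBundle ∞ F E 𝓘(ℝ, EB)]
  [∀ x, IsTopologicalAddGroup (E x)] [∀ x, ContinuousSMul ℝ (E x)]

set_option synthInstance.maxHeartbeats 200000 in
-- The coordinate change substitutes the transition map of `E` into the arguments and applies
-- another one to the value. Both operations depend smoothly on the transition maps.
theorem contMDiffOn_continuousAlternatingMapCoordChange (k : ℕ)
    (e₁ e₁' e₂ e₂' : Trivialization F (TotalSpace.proj : TotalSpace F E → B))
    [MemTrivializationAtlas e₁] [MemTrivializationAtlas e₁'] [MemTrivializationAtlas e₂]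
    [MemTrivializationAtlas e₂'] :
    ContMDiffOn 𝓘(ℝ, EB) 𝓘(ℝ, (F [⋀^Fin k]→L[ℝ] F) →L[ℝ] (F [⋀^Fin k]→L[ℝ] F)) ∞
      (Pretrivialization.continuousAlternatingMapCoordChange ℝ (Fin k) e₁ e₁' e₂ e₂')
      (e₁.baseSet ∩ e₂.baseSet ∩ (e₁'.baseSet ∩ e₂'.baseSet)) := by
  simp +unfoldPartialApp only [Pretrivialization.continuousAlternatingMapCoordChange,
    ContinuousLinearEquiv.coe_continuousAlternatingMapCongr, ContinuousLinearEquiv.symm_symm]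
  refine ContMDiffOn.clm_comp ?_ ?_
  · refine (ContDiff.contMDiff (contDiff_compContinuousAlternatingMapCLM k)).comp_contMDiffOn
      ((contMDiffOn_coordChangeL e₂ e₂').mono ?_)
    mfld_set_tac
  · refine (ContDiff.contMDiff (contDiff_compContinuousLinearMapCLM k)).comp_contMDiffOn
      ((contMDiffOn_coordChangeL e₁' e₁).mono ?_)
    mfld_set_tac

instance isContMDiff_alternating_vectorPrebundle (k : ℕ) :
    (Bundle.ContinuousAlternatingMap.vectorPrebundle ℝ (Fin k) F E F E).IsContMDiff
      𝓘(ℝ, EB) ∞ where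
  exists_contMDiffCoordChange := by
    rintro _ ⟨e₁, e₂, he₁, he₂, rfl⟩ _ ⟨e₁', e₂', he₁', he₂', rfl⟩
    exact ⟨Pretrivialization.continuousAlternatingMapCoordChange ℝ (Fin k) e₁ e₁' e₂ e₂',
      contMDiffOn_continuousAlternatingMapCoordChange k e₁ e₁' e₂ e₂',
      Pretrivialization.continuousAlternatingMapCoordChange_apply⟩

/-- Needed to pass between sections of the pulled back bundle of forms and smooth functions of the
coordinates, in both directions. -/
instance contMDiffVectorBundle_alternating (k : ℕ) :
    ContMDiffVectorBundle ∞ (F [⋀^Fin k]→L[ℝ] F) (fun x => E x [⋀^Fin k]→L[ℝ] E x) 𝓘(ℝ, EB) :=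
  (Bundle.ContinuousAlternatingMap.vectorPrebundle ℝ (Fin k) F E F E).contMDiffVectorBundle
    𝓘(ℝ, EB)

end AlternatingBundle

/-! ### Extension of local sections by zero. -/

section CutOff
variable {EM : Type*} [NormedAddCommGroup EM] [NormedSpace ℝ EM] {HM : Type*} [TopologicalSpace HM]
  {I : ModelWithCorners ℝ EM HM} {M : Type*} [TopologicalSpace M] [ChartedSpace HM M]
  {EB : Type*} [NormedAddCommGroup EB] [NormedSpace ℝ EB] {HB : Type*} [TopologicalSpace HB]
  {J : ModelWithCorners ℝ EB HB} {B : Type*} [TopologicalSpace B]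
  [ChartedSpace HB B]
  {G : Type*} [NormedAddCommGroup G] [NormedSpace ℝ G] {V : B → Type*}
  [TopologicalSpace (TotalSpace G V)] [∀ x, AddCommGroup (V x)] [∀ x, Module ℝ (V x)]
  [∀ x, TopologicalSpace (V x)] [FiberBundle G V] [VectorBundle ℝ G V]
  [ContMDiffVectorBundle ∞ G V J]

/-- A section along a map which is smooth in a trivialization becomes globally smooth when multiplied by a
function with small support. -/
theorem contMDiff_cutoff_symm {q : M → B} (hq : ContMDiff I J ∞ q) {ψ : M → ℝ}
    (hψ : ContMDiff I 𝓘(ℝ, ℝ) ∞ ψ) (e : Trivialization G (TotalSpace.proj : TotalSpace G V → B))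
    [MemTrivializationAtlas e] {g : M → G} {N : Set M} (hN : IsOpen N) (hψN : tsupport ψ ⊆ N)
    (hNe : ∀ m ∈ N, q m ∈ e.baseSet) (hg : ContMDiffOn I 𝓘(ℝ, G) ∞ g N) :
    ContMDiff I (J.prod 𝓘(ℝ, G)) ∞
      (fun m => (⟨q m, ψ m • e.symm (q m) (g m)⟩ : TotalSpace G V)) := by
  intro m
  by_cases hm : m ∈ tsupport ψ
  · have hmN := hψN hm
    refine (e.contMDiffAt_iff (e.mem_source.2 (hNe m hmN))).2 ⟨hq m, ?_⟩
    refine ((hψ m).smul (hg.contMDiffAt (hN.mem_nhds hmN))).congr_of_eventuallyEq ?_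
    filter_upwards [hN.mem_nhds hmN] with m' hm'
    have hlin := (e.linear ℝ (hNe m' hm')).2 (ψ m') (e.symm (q m') (g m'))
    refine hlin.trans ?_
    rw [e.apply_mk_symm (hNe m' hm')]
    rfl
  · refine (((contMDiff_zeroSection ℝ V (n := ∞)).comp hq) m).congr_of_eventuallyEq ?_
    filter_upwards [(isClosed_tsupport ψ).isOpen_compl.mem_nhds hm] with m' hm'
    simp [image_eq_zero_of_notMem_tsupport hm', zeroSection]

end CutOff

/-! ### Gluing local solutions by a partition of unity on the base. -/

section Gluing
variable {EB : Type*} [NormedAddCommGroup EB] [NormedSpace ℝ EB] [FiniteDimensional ℝ EB]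
  {B : Type*} [TopologicalSpace B] [ChartedSpace EB B] [IsManifold 𝓘(ℝ, EB) ∞ B]
  [T2Space B] [SecondCountableTopology B]
  {F : Type*} [NormedAddCommGroup F] [NormedSpace ℝ F] {E : B → Type*}
  [TopologicalSpace (TotalSpace F E)] [∀ x, AddCommGroup (E x)] [∀ x, Module ℝ (E x)]
  [∀ x, TopologicalSpace (E x)] [FiberBundle F E] [VectorBundle ℝ F E]
  [ContMDiffVectorBundle ∞ F E 𝓘(ℝ, EB)]

variable (F E) in
/-- The pullback to the total space of a smooth function on the base. -/
def pullbackFunction (f : C^∞⟮𝓘(ℝ, EB), B; ℝ⟯) : TotalFunctions EB F E :=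
  ⟨fun p => f p.proj, f.contMDiff.comp (contMDiff_proj E)⟩

/-- Pointwise linear equations on families of vectors that can be solved near every point of the base can be
solved globally, by a partition of unity on the base. -/
theorem exists_solution_of_local {W Y : TotalSpace F E → Type*} [∀ p, AddCommGroup (W p)]
    [∀ p, Module ℝ (W p)] [∀ p, AddCommGroup (Y p)] [∀ p, Module ℝ (Y p)]
    (S : Submodule (TotalFunctions EB F E) (∀ p, W p))
    (hS : ∀ σ, (∀ p₀, ∃ τ ∈ S, ∀ᶠ p in 𝓝 p₀, σ p = τ p) → σ ∈ S)
    (T : ∀ p, W p →ₗ[ℝ] Y p) (y : ∀ p, Y p)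
    (h : ∀ x₀ : B, ∃ σ ∈ S, ∀ᶠ x in 𝓝 x₀, ∀ p : TotalSpace F E, p.proj = x → T p (σ p) = y p) :
    ∃ σ ∈ S, ∀ p, T p (σ p) = y p := by
  choose σ hσ hloc using h
  have : LocallyCompactSpace B := Manifold.locallyCompact_of_finiteDimensional 𝓘(ℝ, EB)
  let U : B → Set B := fun x₀ =>
    _root_.interior {x | ∀ p : TotalSpace F E, p.proj = x → T p (σ x₀ p) = y p}
  obtain ⟨ρ, hρ⟩ := SmoothPartitionOfUnity.exists_isSubordinate 𝓘(ℝ, EB) isClosed_univ U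
    (fun _ => isOpen_interior) fun x _ => Set.mem_iUnion.2 ⟨x, mem_interior_iff_mem_nhds.2 (hloc x)⟩
  -- One finite index set serves a whole neighbourhood, so the glued family agrees locally with a
  -- finite combination in `S`, as `hS` requires.
  have hfin : ∀ x₀ : B, ∃ s : Finset B, ∀ᶠ x in 𝓝 x₀, Function.support (fun i => ρ i x) ⊆ s := by
    intro x₀
    obtain ⟨t, ht, hf⟩ := ρ.locallyFinite x₀
    refine ⟨hf.toFinset, ?_⟩
    filter_upwards [ht] with x hx i hi
    simp only [Set.Finite.coe_toFinset, Set.mem_ofPred_eq]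
    exact ⟨x, hi, hx⟩
  have hsum : ∀ (s : Finset B) (p : TotalSpace F E),
      Function.support (fun i => ρ i p.proj) ⊆ s →
      ∑ᶠ i, ρ i p.proj • σ i p = ∑ i ∈ s, ρ i p.proj • σ i p := by
    intro s p hs
    refine finsum_eq_sum_of_support_subset _ fun i hi => hs fun h0 => hi ?_
    simp only [h0, zero_smul]
  refine ⟨fun p => ∑ᶠ i, ρ i p.proj • σ i p, hS _ fun p₀ => ?_, fun p => ?_⟩
  · obtain ⟨s, hs⟩ := hfin p₀.proj
    refine ⟨∑ i ∈ s, pullbackFunction F E (ρ i) • σ i,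
      S.sum_mem fun i _ => S.smul_mem _ (hσ i), ?_⟩
    filter_upwards [(FiberBundle.continuous_proj F E).continuousAt.eventually hs] with p hp
    rw [hsum s p hp, Finset.sum_apply]
    rfl
  · obtain ⟨s, hs⟩ := hfin p.proj
    have hs := hs.self_of_nhds
    have h1 : ∑ i ∈ s, ρ i p.proj = 1 := by
      rw [← finsum_eq_sum_of_support_subset _ hs]
      exact ρ.sum_eq_one (Set.mem_univ _)
    change T p (∑ᶠ i, ρ i p.proj • σ i p) = y p
    rw [hsum s p hs, map_sum, ← one_smul ℝ (y p), ← h1, Finset.sum_smul]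
    refine Finset.sum_congr rfl fun i _ => ?_
    rw [map_smul]
    -- Only the indices with `ρ i ≠ 0` contribute, and for those the base point lies in `U i`, where
    -- `σ i` solves the equation. The weights then add up to 1.
    by_cases hi : ρ i p.proj = 0
    · simp [hi]
    · have hp : p.proj ∈ U i := hρ i (subset_tsupport _ hi)
      rw [interior_subset hp p rfl]

omit [FiniteDimensional ℝ EB] [T2Space B] [SecondCountableTopology B]
  [IsManifold 𝓘(ℝ, EB) ∞ B] [ContMDiffVectorBundle ∞ F E 𝓘(ℝ, EB)] in
-- Smoothness is a local condition. This is the hypothesis `hS` of `exists_solution_of_local`, as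
-- `glSections_of_local` is for sections of `π* gl(E)`.
theorem pullbackSections_of_local {G : Type*} [NormedAddCommGroup G] [NormedSpace ℝ G]
    {V : B → Type*} [TopologicalSpace (TotalSpace G V)] [∀ x, AddCommGroup (V x)]
    [∀ x, Module ℝ (V x)] [∀ x, TopologicalSpace (V x)] [FiberBundle G V] [VectorBundle ℝ G V]
    (σ : ∀ p : TotalSpace F E, V p.proj)
    (h : ∀ p₀, ∃ τ ∈ pullbackSections EB F E G V, ∀ᶠ p in 𝓝 p₀, σ p = τ p) :
    σ ∈ pullbackSections EB F E G V := by
  intro p₀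
  obtain ⟨τ, hτ, hp⟩ := h p₀
  refine (hτ p₀).congr_of_eventuallyEq ?_
  filter_upwards [hp] with p h
  rw [h]

omit [SecondCountableTopology B] [FiniteDimensional ℝ EB] [T2Space B] in
theorem glSections_of_local [∀ x, IsTopologicalAddGroup (E x)] [∀ x, ContinuousSMul ℝ (E x)]
    (σ : ∀ p : TotalSpace F E, GlFibre EB F E p.proj)
    (h : ∀ p₀, ∃ τ ∈ glSections EB F E, ∀ᶠ p in 𝓝 p₀, σ p = τ p) :
    σ ∈ glSections EB F E := by
  intro p₀
  obtain ⟨τ, hτ, hp⟩ := h p₀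
  obtain ⟨τ', hτ', hp'⟩ := hτ p₀
  exact ⟨τ', hτ', by filter_upwards [hp, hp'] with p h1 h2; rw [h1, h2]⟩

end Gluing

/-! ### Charts of the total space that contain whole fibres. -/

section FibreChart
variable {EB : Type*} [NormedAddCommGroup EB] [NormedSpace ℝ EB]
  {B : Type*} [TopologicalSpace B] [ChartedSpace EB B] [IsManifold 𝓘(ℝ, EB) ∞ B]
  {F : Type*} [NormedAddCommGroup F] [NormedSpace ℝ F] {E : B → Type*}
  [TopologicalSpace (TotalSpace F E)] [∀ x, AddCommGroup (E x)] [∀ x, Module ℝ (E x)]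
  [∀ x, TopologicalSpace (E x)] [FiberBundle F E] [VectorBundle ℝ F E]
  [ContMDiffVectorBundle ∞ F E 𝓘(ℝ, EB)]

local notation "IE" => ModelWithCorners.prod (modelWithCornersSelf ℝ EB) (modelWithCornersSelf ℝ F)

variable (EB F E) in
/-- The part of the base over which the chart of the total space around `0 ∈ E x₀` is defined. -/
def chartBase (x₀ : B) : Set B := (chartAt EB x₀).source ∩ (trivializationAt F E x₀).baseSet

variable (EB F E) in
/-- The domain of the coordinates on the base. -/
def chartDomain (x₀ : B) : Set EB :=
  (extChartAt 𝓘(ℝ, EB) x₀).target ∩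
    (extChartAt 𝓘(ℝ, EB) x₀).symm ⁻¹' (trivializationAt F E x₀).baseSet

variable (EB F E) in
/-- The chart of the total space around `0 ∈ E x₀`. -/
abbrev fibreChart (x₀ : B) : PartialEquiv (TotalSpace F E) (EB × F) :=
  extChartAt IE (zeroSection F E x₀)

theorem isOpen_chartBase (x₀ : B) : IsOpen (chartBase EB F E x₀) :=
  (chartAt EB x₀).open_source.inter (trivializationAt F E x₀).open_baseSet

theorem chartBase_mem_nhds (x₀ : B) : chartBase EB F E x₀ ∈ 𝓝 x₀ :=
  (isOpen_chartBase x₀).mem_nhds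
    ⟨mem_chart_source EB x₀, FiberBundle.mem_baseSet_trivializationAt' x₀⟩

theorem isOpen_preimage_chartBase (x₀ : B) :
    IsOpen (TotalSpace.proj ⁻¹' chartBase EB F E x₀ : Set (TotalSpace F E)) :=
  (isOpen_chartBase x₀).preimage (FiberBundle.continuous_proj F E)

theorem fibreChart_target (x₀ : B) :
    (fibreChart EB F E x₀).target = chartDomain EB F E x₀ ×ˢ Set.univ :=
  FiberBundle.extChartAt_target _

theorem isOpen_chartDomain (x₀ : B) : IsOpen (chartDomain EB F E x₀) :=
  (continuousOn_extChartAt_symm x₀).isOpen_inter_preimage (isOpen_extChartAt_target x₀)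
    (trivializationAt F E x₀).open_baseSet

theorem fibreChart_apply (x₀ : B) (p : TotalSpace F E) (hp : p.proj ∈ chartBase EB F E x₀) :
    fibreChart EB F E x₀ p =
      (chartAt EB x₀ p.proj, (trivializationAt F E x₀ p).2) := by
  rw [fibreChart, FiberBundle.extChartAt]
  change (chartAt EB x₀ (trivializationAt F E x₀ p).1, (trivializationAt F E x₀ p).2) = _
  rw [(trivializationAt F E x₀).coe_fst' hp.2]

theorem fibreChart_source (x₀ : B) :
    (fibreChart EB F E x₀).source = TotalSpace.proj ⁻¹' chartBase EB F E x₀ := by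
  rw [fibreChart, FiberBundle.extChartAt]
  ext p
  simp only [zeroSection, PartialEquiv.trans_source, Set.mem_inter_iff,
    Set.mem_preimage, chartBase]
  constructor
  · rintro ⟨h1, h2⟩
    have h1 : p.proj ∈ (trivializationAt F E x₀).baseSet :=
      (trivializationAt F E x₀).mem_source.1 h1
    refine ⟨?_, h1⟩
    have h3 := h2.1
    rw [extChartAt_source] at h3
    rw [← (trivializationAt F E x₀).coe_fst' h1]
    exact h3
  · rintro ⟨h1, h2⟩
    refine ⟨(trivializationAt F E x₀).mem_source.2 h2, ?_, trivial⟩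
    rw [extChartAt_source]
    rw [← (trivializationAt F E x₀).coe_fst' h2] at h1
    exact h1

theorem fibreChart_mapsTo {x₀ : B} {p : TotalSpace F E} (hp : p.proj ∈ chartBase EB F E x₀) :
    fibreChart EB F E x₀ p ∈ chartDomain EB F E x₀ ×ˢ Set.univ := by
  rw [← fibreChart_target]
  exact (fibreChart EB F E x₀).map_source (by rw [fibreChart_source]; exact hp)

theorem fibreChart_left_inv {x₀ : B} {p : TotalSpace F E} (hp : p.proj ∈ chartBase EB F E x₀) :
    (fibreChart EB F E x₀).symm (fibreChart EB F E x₀ p) = p :=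
  (fibreChart EB F E x₀).left_inv (by rw [fibreChart_source]; exact hp)

theorem fibreChart_right_inv {x₀ : B} {u : EB} (hu : u ∈ chartDomain EB F E x₀) (y : F) :
    fibreChart EB F E x₀ ((fibreChart EB F E x₀).symm (u, y)) = (u, y) :=
  (fibreChart EB F E x₀).right_inv (by rw [fibreChart_target]; exact ⟨hu, trivial⟩)

theorem fibreChart_symm_proj_mem {x₀ : B} {u : EB} (hu : u ∈ chartDomain EB F E x₀) (y : F) :
    ((fibreChart EB F E x₀).symm (u, y)).proj ∈ chartBase EB F E x₀ := by
  have := (fibreChart EB F E x₀).map_target (x := (u, y))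
    (by rw [fibreChart_target]; exact ⟨hu, trivial⟩)
  rwa [fibreChart_source] at this

theorem trivialization_fibreChart_symm {x₀ : B} {u : EB} (hu : u ∈ chartDomain EB F E x₀) (y : F) :
    (trivializationAt F E x₀ ((fibreChart EB F E x₀).symm (u, y))).2 = y := by
  have := fibreChart_right_inv hu y
  rw [fibreChart_apply x₀ _ (fibreChart_symm_proj_mem hu y)] at this
  exact congrArg Prod.snd this

theorem chartAt_fibreChart_symm {x₀ : B} {u : EB} (hu : u ∈ chartDomain EB F E x₀) (y : F) :
    chartAt EB x₀ ((fibreChart EB F E x₀).symm (u, y)).proj = u := by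
  have := fibreChart_right_inv hu y
  rw [fibreChart_apply x₀ _ (fibreChart_symm_proj_mem hu y)] at this
  exact congrArg Prod.fst this

theorem contMDiffOn_fibreChart (x₀ : B) :
    ContMDiffOn IE 𝓘(ℝ, EB × F) ∞ (fibreChart EB F E x₀)
      (TotalSpace.proj ⁻¹' chartBase EB F E x₀) := by
  rw [← fibreChart_source, fibreChart, extChartAt_source]
  exact contMDiffOn_extChartAt

theorem contMDiffOn_fibreChart_symm (x₀ : B) :
    ContMDiffOn 𝓘(ℝ, EB × F) IE ∞ (fibreChart EB F E x₀).symm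
      (chartDomain EB F E x₀ ×ˢ Set.univ) := by
  rw [← fibreChart_target]
  exact contMDiffOn_extChartAt_symm _

theorem tsupport_comp_proj_subset {χ : B → ℝ} {U : Set B} (h : tsupport χ ⊆ U) :
    tsupport (fun p : TotalSpace F E => χ p.proj) ⊆ TotalSpace.proj ⁻¹' U := by
  have h1 : tsupport (fun p : TotalSpace F E => χ p.proj) ⊆ TotalSpace.proj ⁻¹' tsupport χ :=
    closure_minimal (fun _ hq => subset_tsupport χ hq)
      ((isClosed_tsupport χ).preimage (FiberBundle.continuous_proj F E))
  exact h1.trans (Set.preimage_mono h)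

/-- A section along the projection, read in trivializations, is a smooth function of the coordinates. -/
theorem contDiffOn_coordinates {G : Type*} [NormedAddCommGroup G] [NormedSpace ℝ G]
    {V : B → Type*} [TopologicalSpace (TotalSpace G V)] [∀ x, AddCommGroup (V x)]
    [∀ x, Module ℝ (V x)] [∀ x, TopologicalSpace (V x)] [FiberBundle G V] [VectorBundle ℝ G V]
    [ContMDiffVectorBundle ∞ G V 𝓘(ℝ, EB)] {s : ∀ p : TotalSpace F E, V p.proj}
    (hs : s ∈ pullbackSections EB F E G V) (x₀ : B)
    (hV : chartBase EB F E x₀ ⊆ (trivializationAt G V x₀).baseSet) :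
    ContDiffOn ℝ ∞ (fun z => (trivializationAt G V x₀
        ⟨((fibreChart EB F E x₀).symm z).proj, s ((fibreChart EB F E x₀).symm z)⟩).2)
      (chartDomain EB F E x₀ ×ˢ Set.univ) := by
  have h1 : ContMDiffOn 𝓘(ℝ, EB × F) (𝓘(ℝ, EB).prod 𝓘(ℝ, G)) ∞ _ _ :=
    (hs : ContMDiff _ _ _ _).comp_contMDiffOn (contMDiffOn_fibreChart_symm x₀)
  rw [← contMDiffOn_iff_contDiffOn]
  refine ((trivializationAt G V x₀).contMDiffOn_iff ?_).1 h1 |>.2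
  rintro ⟨u, y⟩ ⟨hu, -⟩
  exact (trivializationAt G V x₀).mem_source.2 (hV (fibreChart_symm_proj_mem hu y))

/-- A smooth function of the coordinates, cut off, defines a section along the projection. -/
theorem cutoff_symm_mem_pullbackSections {G : Type*} [NormedAddCommGroup G] [NormedSpace ℝ G]
    {V : B → Type*} [TopologicalSpace (TotalSpace G V)] [∀ x, AddCommGroup (V x)]
    [∀ x, Module ℝ (V x)] [∀ x, TopologicalSpace (V x)] [FiberBundle G V] [VectorBundle ℝ G V]
    [ContMDiffVectorBundle ∞ G V 𝓘(ℝ, EB)] (x₀ : B)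
    (hV : chartBase EB F E x₀ ⊆ (trivializationAt G V x₀).baseSet)
    {b : EB × F → G} (hb : ContDiffOn ℝ ∞ b (chartDomain EB F E x₀ ×ˢ Set.univ))
    {χ : C^∞⟮𝓘(ℝ, EB), B; ℝ⟯} (hχ : tsupport χ ⊆ chartBase EB F E x₀) :
    (fun p : TotalSpace F E => χ p.proj •
      (trivializationAt G V x₀).symm p.proj (b (fibreChart EB F E x₀ p))) ∈
      pullbackSections EB F E G V :=
  contMDiff_cutoff_symm (contMDiff_proj E) (χ.contMDiff.comp (contMDiff_proj E)) _
    (isOpen_preimage_chartBase x₀) (tsupport_comp_proj_subset hχ) (fun _ hp => hV hp)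
    (hb.contMDiffOn.comp (contMDiffOn_fibreChart x₀) fun _ hp => fibreChart_mapsTo hp)

end FibreChart

/-! ### Exactness of the Koszul complex of the bundle. -/

section KoszulBundle
variable {EB : Type*} [NormedAddCommGroup EB] [NormedSpace ℝ EB] [FiniteDimensional ℝ EB]
  {B : Type*} [TopologicalSpace B] [ChartedSpace EB B] [IsManifold 𝓘(ℝ, EB) ∞ B]
  [T2Space B] [SecondCountableTopology B]
  {F : Type*} [NormedAddCommGroup F] [NormedSpace ℝ F] [FiniteDimensional ℝ F] {E : B → Type*}
  [TopologicalSpace (TotalSpace F E)] [∀ x, AddCommGroup (E x)] [∀ x, Module ℝ (E x)]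
  [∀ x, TopologicalSpace (E x)]
  [∀ x, IsTopologicalAddGroup (E x)] [∀ x, ContinuousSMul ℝ (E x)]
  [FiberBundle F E] [VectorBundle ℝ F E]
  [ContMDiffVectorBundle ∞ F E 𝓘(ℝ, EB)]

variable (F E) in
/-- The trivialization of the bundle of alternating forms around a point of the base. -/
abbrev altTrivialization (k : ℕ) (x₀ : B) :=
  trivializationAt (F [⋀^Fin k]→L[ℝ] F) (fun x : B => E x [⋀^Fin k]→L[ℝ] E x) x₀

/-- The trivialization of forms is induced by that of `E`, hence compatible with contraction. In
coordinates, contraction with the tautological section becomes contraction with `y`. -/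
theorem altTrivialization_interior {k : ℕ} {x₀ x : B}
    (hx : x ∈ (trivializationAt F E x₀).baseSet) (v : E x) (α : E x [⋀^Fin (k + 1)]→L[ℝ] E x) :
    (altTrivialization F E k x₀ ⟨x, interior v α⟩).2 =
      curryLeftCLM F F k (altTrivialization F E (k + 1) x₀ ⟨x, α⟩).2
        (trivializationAt F E x₀ ⟨x, v⟩).2 := by
  have hy : (trivializationAt F E x₀).symm x (trivializationAt F E x₀ ⟨x, v⟩).2 = v :=
    (trivializationAt F E x₀).symm_apply_apply_mk hx v
  change ContinuousAlternatingMap.inCoordinates F F x₀ x x₀ x (interior v α) =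
    (ContinuousAlternatingMap.inCoordinates F F x₀ x x₀ x α).curryLeft
      (trivializationAt F E x₀ ⟨x, v⟩).2
  ext w
  refine congrArg ((trivializationAt F E x₀).continuousLinearMapAt ℝ x) ?_
  refine congrArg α (funext fun i => ?_)
  refine Fin.cases ?_ (fun j => ?_) i
  · exact hy.symm.trans (Trivialization.symmL_apply _ hx _).symm
  · rfl

variable (EB F E) in
theorem chartBase_subset_altTrivialization (k : ℕ) (x₀ : B) :
    chartBase EB F E x₀ ⊆ (altTrivialization F E k x₀).baseSet :=
  fun _ hx => ⟨hx.2, hx.2⟩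

theorem altTrivialization_zero {k : ℕ} {x₀ x : B} (hx : x ∈ (trivializationAt F E x₀).baseSet) :
    (altTrivialization F E k x₀ ⟨x, 0⟩).2 = 0 :=
  ((altTrivialization F E k x₀).linear ℝ (b := x) ⟨hx, hx⟩).map_zero

/-- The interior product with a vector, as a linear map. -/
def interiorLinear {x : B} (k : ℕ) (v : E x) :
    (E x [⋀^Fin (k + 1)]→L[ℝ] E x) →ₗ[ℝ] (E x [⋀^Fin k]→L[ℝ] E x) where
  toFun := interior v
  map_add' _ _ := rfl
  map_smul' _ _ := rfl

variable (EB F E) in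
/-- The Koszul complex of the tautological section is exact in positive degrees. -/
theorem exact_contraction (j : ℕ) :
    Function.Exact (contraction EB F E (j + 1)) (contraction EB F E j) := by
  intro α
  constructor
  · intro hα
    suffices h : ∃ β ∈ AltSections EB F E (j + 2), ∀ p : TotalSpace F E,
        interiorLinear (j + 1) p.2 (β p) = α.1 p by
      obtain ⟨β, hβ, h⟩ := h
      exact ⟨⟨β, hβ⟩, Subtype.ext (funext h)⟩
    refine exists_solution_of_local (AltSections EB F E (j + 2))
      (pullbackSections_of_local (V := fun x : B => E x [⋀^Fin (j + 2)]→L[ℝ] E x)) (fun p => interiorLinear (j + 1) p.2) α.1 fun x₀ => ?_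
    -- The primitive exists over all of `chartDomain × F`. The cut-off is needed only in the base
    -- direction, so the solution is valid on entire fibres near `x₀`.
    obtain ⟨b, hb, hb'⟩ := exists_contDiffOn_curryLeft_eq (isOpen_chartDomain x₀)
      (contDiffOn_coordinates α.2 x₀ (chartBase_subset_altTrivialization EB F E (j + 1) x₀))
      (fun u hu y => by
        have hx := (fibreChart_symm_proj_mem hu y).2
        have h1 := altTrivialization_interior hx ((fibreChart EB F E x₀).symm (u, y)).2
          (α.1 ((fibreChart EB F E x₀).symm (u, y)))
        rw [trivialization_fibreChart_symm hu y] at h1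
        refine h1.symm.trans ?_
        have h2 : interior ((fibreChart EB F E x₀).symm (u, y)).2
            (α.1 ((fibreChart EB F E x₀).symm (u, y))) = 0 :=
          congrFun (congrArg Subtype.val hα) _
        rw [h2]
        exact altTrivialization_zero hx)
    obtain ⟨χ, h1, hχ⟩ := exists_bump (EB := EB) x₀ (chartBase_mem_nhds (EB := EB) (F := F) (E := E) x₀)
    refine ⟨_, cutoff_symm_mem_pullbackSections x₀
      (chartBase_subset_altTrivialization EB F E (j + 2) x₀) hb hχ, ?_⟩
    filter_upwards [h1, chartBase_mem_nhds (EB := EB) (F := F) (E := E) x₀] with x hx1 hx p hp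
    subst hp
    have hmem := fibreChart_mapsTo hx
    refine trivialization_inj (chartBase_subset_altTrivialization EB F E (j + 1) x₀ hx) ?_
    refine (altTrivialization_interior hx.2 _ _).trans ?_
    rw [hx1, one_smul, (altTrivialization F E (j + 2) x₀).apply_mk_symm
      (chartBase_subset_altTrivialization EB F E (j + 2) x₀ hx)]
    have h3 := hb' _ hmem.1 (fibreChart EB F E x₀ p).2
    rw [Prod.mk.eta, fibreChart_left_inv hx] at h3
    rw [← h3]
    congr 1
  · rintro ⟨β, rfl⟩
    refine Subtype.ext (funext fun p => ContinuousAlternatingMap.ext fun w => ?_)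
    -- Contracting twice puts the same vector `p` into the first two slots.
    refine (β.1 p).map_eq_zero_of_eq _ (i := 0) (j := 1) ?_ (by simp)
    rfl

end KoszulBundle

/-! ### Linear vector fields in coordinates. -/

section LinearFields
variable {EB : Type*} [NormedAddCommGroup EB] [NormedSpace ℝ EB]
  {B : Type*} [TopologicalSpace B] [ChartedSpace EB B] [IsManifold 𝓘(ℝ, EB) ∞ B]
  {F : Type*} [NormedAddCommGroup F] [NormedSpace ℝ F] {E : B → Type*}
  [TopologicalSpace (TotalSpace F E)] [∀ x, AddCommGroup (E x)] [∀ x, Module ℝ (E x)]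
  [∀ x, TopologicalSpace (E x)] [FiberBundle F E] [VectorBundle ℝ F E]
  [ContMDiffVectorBundle ∞ F E 𝓘(ℝ, EB)]

local notation "IE" => ModelWithCorners.prod (modelWithCornersSelf ℝ EB) (modelWithCornersSelf ℝ F)

variable (EB F E) in
/-- The trivialization of the tangent bundle of the total space given by the chart `fibreChart`. -/
abbrev tangentTrivialization (x₀ : B) :=
  trivializationAt (EB × F) (TangentSpace IE : TotalSpace F E → Type _) (zeroSection F E x₀)

variable (F E) in
/-- The trivialization of the dual bundle around a point of the base. -/
abbrev dualTrivialization (x₀ : B) :=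
  trivializationAt (F →L[ℝ] ℝ) (fun x : B => E x →L[ℝ] Bundle.Trivial B ℝ x) x₀

theorem tangentTrivialization_baseSet (x₀ : B) :
    (tangentTrivialization EB F E x₀).baseSet = TotalSpace.proj ⁻¹' chartBase EB F E x₀ := by
  rw [← fibreChart_source, extChartAt_source]
  exact TangentBundle.trivializationAt_baseSet _

theorem chartAt_mem_chartDomain {x₀ x : B} (hx : x ∈ chartBase EB F E x₀) :
    chartAt EB x₀ x ∈ chartDomain EB F E x₀ := by
  have h := fibreChart_mapsTo (EB := EB) (p := zeroSection F E x) hx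
  rw [fibreChart_apply x₀ _ hx] at h
  exact h.1

theorem fibreChart_symm_proj {x₀ : B} {u : EB} (hu : u ∈ chartDomain EB F E x₀) (y : F) :
    ((fibreChart EB F E x₀).symm (u, y)).proj = (chartAt EB x₀).symm u := by
  have h := (chartAt EB x₀).left_inv (fibreChart_symm_proj_mem hu y).1
  rw [← h, chartAt_fibreChart_symm hu y]

theorem chartAt_symm_mem {x₀ : B} {u : EB} (hu : u ∈ chartDomain EB F E x₀) :
    (chartAt EB x₀).symm u ∈ chartBase EB F E x₀ := by
  rw [← fibreChart_symm_proj hu 0]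
  exact fibreChart_symm_proj_mem hu 0

theorem contMDiffOn_chartAt_symm (x₀ : B) :
    ContMDiffOn 𝓘(ℝ, EB) 𝓘(ℝ, EB) ∞ (chartAt EB x₀).symm (chartDomain EB F E x₀) :=
  (contMDiffOn_extChartAt_symm (I := 𝓘(ℝ, EB)) (n := ∞) x₀).mono Set.inter_subset_left

theorem contMDiffOn_chartAt_chartBase (x₀ : B) :
    ContMDiffOn 𝓘(ℝ, EB) 𝓘(ℝ, EB) ∞ (chartAt EB x₀) (chartBase EB F E x₀) :=
  (contMDiffOn_extChartAt (I := 𝓘(ℝ, EB)) (n := ∞)).mono Set.inter_subset_left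

/-- The inverse of the tangent trivialization is the derivative of the inverse chart, so this is the
chain rule. It lets derivations be computed in the coordinates `(u, y)`. -/
theorem mfderiv_tangentTrivialization_symm {x₀ : B} {p : TotalSpace F E}
    (hp : p.proj ∈ chartBase EB F E x₀) {f : TotalSpace F E → ℝ}
    (hf : MDifferentiableAt IE 𝓘(ℝ, ℝ) f p) (w : EB × F) :
    mfderiv IE 𝓘(ℝ, ℝ) f p ((tangentTrivialization EB F E x₀).symm p w) =
      fderiv ℝ (f ∘ (fibreChart EB F E x₀).symm) (fibreChart EB F E x₀ p) w := by
  have hb : p ∈ (tangentTrivialization EB F E x₀).baseSet := by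
    rw [tangentTrivialization_baseSet]; exact hp
  have hs : p ∈ (chartAt (ModelProd EB F) (zeroSection F E x₀)).source := by
    rw [← extChartAt_source IE, fibreChart_source]; exact hp
  have hI : Set.range IE = Set.univ := ModelWithCorners.range_eq_univ IE
  have h1 : (tangentTrivialization EB F E x₀).symm p w =
      mfderiv 𝓘(ℝ, EB × F) IE (fibreChart EB F E x₀).symm (fibreChart EB F E x₀ p) w := by
    rw [← Trivialization.symmL_apply (R := ℝ) _ hb, TangentBundle.symmL_trivializationAt hs, hI,
      mfderivWithin_univ]
    rfl
  have hd : MDifferentiableAt 𝓘(ℝ, EB × F) IE (fibreChart EB F E x₀).symm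
      (fibreChart EB F E x₀ p) :=
    ((contMDiffOn_fibreChart_symm x₀).contMDiffAt
      (((isOpen_chartDomain x₀).prod isOpen_univ).mem_nhds
        (fibreChart_mapsTo hp))).mdifferentiableAt (by simp)
  have hq := fibreChart_left_inv hp
  have hf' : MDifferentiableAt IE 𝓘(ℝ, ℝ) f
      ((fibreChart EB F E x₀).symm (fibreChart EB F E x₀ p)) := by rw [hq]; exact hf
  have hc := mfderiv_comp (fibreChart EB F E x₀ p) hf' hd
  have h2 : ∀ q : TotalSpace F E, q = p →
    (mfderiv IE 𝓘(ℝ, ℝ) f p : EB × F →L[ℝ] ℝ) = mfderiv IE 𝓘(ℝ, ℝ) f q := by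
    rintro q rfl; rfl
  rw [h1, ← mfderiv_eq_fderiv, hc]
  exact congrArg (fun A : EB × F →L[ℝ] ℝ => A (mfderiv 𝓘(ℝ, EB × F) IE
    (fibreChart EB F E x₀).symm (fibreChart EB F E x₀ p) w)) (h2 _ hq)

variable (EB) in
/-- A function on the base, in coordinates. -/
def functionCoord (g : B → ℝ) (x₀ : B) (u : EB) : ℝ := g ((chartAt EB x₀).symm u)

variable (EB) in
/-- A section of the dual bundle, in coordinates. -/
def dualCoord (φ : DualSections EB F E) (x₀ : B) (u : EB) : F →L[ℝ] ℝ :=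
  (dualTrivialization F E x₀ ⟨(chartAt EB x₀).symm u, φ ((chartAt EB x₀).symm u)⟩).2

theorem contDiffOn_functionCoord (g : C^∞⟮𝓘(ℝ, EB), B; ℝ⟯) (x₀ : B) :
    ContDiffOn ℝ ∞ (functionCoord EB g x₀) (chartDomain EB F E x₀) :=
  contMDiffOn_iff_contDiffOn.1 (g.contMDiff.comp_contMDiffOn (contMDiffOn_chartAt_symm x₀))

variable (EB F E) in
theorem chartBase_subset_dualTrivialization (x₀ : B) :
    chartBase EB F E x₀ ⊆ (dualTrivialization F E x₀).baseSet :=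
  fun _ hx => ⟨hx.2, trivial⟩

theorem contDiffOn_dualCoord (φ : DualSections EB F E) (x₀ : B) :
    ContDiffOn ℝ ∞ (dualCoord EB φ x₀) (chartDomain EB F E x₀) := by
  refine contMDiffOn_iff_contDiffOn.1 ?_
  have h := φ.contMDiff.comp_contMDiffOn (contMDiffOn_chartAt_symm (F := F) (E := E) x₀)
  exact (((dualTrivialization F E x₀).contMDiffOn_iff fun u hu =>
    (dualTrivialization F E x₀).mem_source.2
      (chartBase_subset_dualTrivialization EB F E x₀ (chartAt_symm_mem hu))).1 h).2

theorem dualTrivialization_apply {x₀ x : B} (hx : x ∈ (trivializationAt F E x₀).baseSet)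
    (l : E x →L[ℝ] Bundle.Trivial B ℝ x) (v : E x) :
    (dualTrivialization F E x₀ ⟨x, l⟩).2 (trivializationAt F E x₀ ⟨x, v⟩).2 = l v := by
  change ContinuousLinearMap.inCoordinates F E ℝ (Bundle.Trivial B ℝ) x₀ x x₀ x l
    (trivializationAt F E x₀ ⟨x, v⟩).2 = l v
  have h : (trivializationAt F E x₀).symm x (trivializationAt F E x₀ ⟨x, v⟩).2 = v :=
    (trivializationAt F E x₀).symm_apply_apply_mk hx v
  simp [ContinuousLinearMap.inCoordinates, hx, h]

theorem mfderiv_pullback_symm {x₀ : B} {p : TotalSpace F E} (hp : p.proj ∈ chartBase EB F E x₀)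
    (g : C^∞⟮𝓘(ℝ, EB), B; ℝ⟯) (w : EB × F) :
    mfderiv IE 𝓘(ℝ, ℝ) (fun q : TotalSpace F E => g q.proj) p
      ((tangentTrivialization EB F E x₀).symm p w) =
      fderiv ℝ (functionCoord EB g x₀) (chartAt EB x₀ p.proj) w.1 := by
  have hg : ContMDiff IE 𝓘(ℝ, ℝ) ∞ (fun q : TotalSpace F E => g q.proj) :=
    g.contMDiff.comp (contMDiff_proj E)
  rw [mfderiv_tangentTrivialization_symm hp (hg.mdifferentiable (by simp) p)]
  have hmem := fibreChart_mapsTo hp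
  have h1 : ((fun q : TotalSpace F E => g q.proj) ∘ (fibreChart EB F E x₀).symm)
      =ᶠ[𝓝 (fibreChart EB F E x₀ p)] fun z => functionCoord EB g x₀ z.1 := by
    filter_upwards [((isOpen_chartDomain x₀).prod isOpen_univ).mem_nhds hmem] with z hz
    exact congrArg g (fibreChart_symm_proj hz.1 z.2)
  have h2 : HasFDerivAt (fun z : EB × F => functionCoord EB g x₀ z.1)
      ((fderiv ℝ (functionCoord EB g x₀) (fibreChart EB F E x₀ p).1).comp
        (ContinuousLinearMap.fst ℝ EB F)) (fibreChart EB F E x₀ p) :=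
    (((contDiffOn_functionCoord g x₀).differentiableOn (by simp)).differentiableAt
      ((isOpen_chartDomain x₀).mem_nhds hmem.1)).hasFDerivAt.comp _ hasFDerivAt_fst
  rw [h1.fderiv_eq, h2.fderiv, fibreChart_apply x₀ p hp]
  rfl

/-- In coordinates the function is `(u, y) ↦ φ(u) y`, and this is the product rule. For `w = (v, C
y)` with constant `v` and `C` both terms are linear in `y`. -/
theorem mfderiv_pairing_symm {x₀ : B} {p : TotalSpace F E} (hp : p.proj ∈ chartBase EB F E x₀)
    (φ : DualSections EB F E) (w : EB × F) 
    (hφ : MDifferentiableAt IE 𝓘(ℝ, ℝ) (fun q : TotalSpace F E => (φ q.proj q.2 : ℝ)) p) :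
    mfderiv IE 𝓘(ℝ, ℝ) (fun q : TotalSpace F E => (φ q.proj q.2 : ℝ)) p
      ((tangentTrivialization EB F E x₀).symm p w) =
      fderiv ℝ (dualCoord EB φ x₀) (chartAt EB x₀ p.proj) w.1 (trivializationAt F E x₀ p).2 +
        dualCoord EB φ x₀ (chartAt EB x₀ p.proj) w.2 := by
  rw [mfderiv_tangentTrivialization_symm hp hφ]
  have hmem := fibreChart_mapsTo hp
  have h1 : ((fun q : TotalSpace F E => (φ q.proj q.2 : ℝ)) ∘ (fibreChart EB F E x₀).symm)
      =ᶠ[𝓝 (fibreChart EB F E x₀ p)] fun z => dualCoord EB φ x₀ z.1 z.2 := by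
    filter_upwards [((isOpen_chartDomain x₀).prod isOpen_univ).mem_nhds hmem] with z hz
    have h2 := dualTrivialization_apply (fibreChart_symm_proj_mem (y := z.2) hz.1).2
      (φ ((fibreChart EB F E x₀).symm (z.1, z.2)).proj) ((fibreChart EB F E x₀).symm (z.1, z.2)).2
    rw [trivialization_fibreChart_symm hz.1] at h2
    refine h2.symm.trans ?_
    rw [dualCoord, fibreChart_symm_proj hz.1]
  have h2 := HasFDerivAt.clm_apply
    ((((contDiffOn_dualCoord φ x₀).differentiableOn (by simp)).differentiableAt
      ((isOpen_chartDomain x₀).mem_nhds hmem.1)).hasFDerivAt.comp _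
        (hasFDerivAt_fst (𝕜 := ℝ) (p := fibreChart EB F E x₀ p)))
    (hasFDerivAt_snd (𝕜 := ℝ) (p := fibreChart EB F E x₀ p))
  rw [h1.fderiv_eq]
  refine (congrArg (fun A : EB × F →L[ℝ] ℝ => A w) h2.fderiv).trans ?_
  rw [fibreChart_apply x₀ p hp]
  simp [add_comm]

variable [∀ x, IsTopologicalAddGroup (E x)] [∀ x, ContinuousSMul ℝ (E x)]

/-- There is a section of the dual bundle with given coordinates, cut off by a function on the base. -/
theorem exists_cutoffDual (x₀ : B) {χ : C^∞⟮𝓘(ℝ, EB), B; ℝ⟯} (hχ : tsupport χ ⊆ chartBase EB F E x₀)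
    {l : B → F →L[ℝ] ℝ} (hl : ContMDiffOn 𝓘(ℝ, EB) 𝓘(ℝ, F →L[ℝ] ℝ) ∞ l (chartBase EB F E x₀)) :
    ∃ ψ : DualSections EB F E,
      (∀ x ∈ (trivializationAt F E x₀).baseSet, ∀ v : E x,
        (ψ x v : ℝ) = χ x * l x (trivializationAt F E x₀ ⟨x, v⟩).2) ∧
      ∀ x, χ x = 0 → ∀ v : E x, (ψ x v : ℝ) = 0 := by
  refine ⟨⟨fun x => χ x • (dualTrivialization F E x₀).symm x (l x),
    contMDiff_cutoff_symm (V := fun x : B => E x →L[ℝ] Bundle.Trivial B ℝ x) (q := id)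
      contMDiff_id χ.contMDiff _ (isOpen_chartBase x₀) hχ
      (chartBase_subset_dualTrivialization EB F E x₀) hl⟩, fun x hx v => ?_, fun x hx v => ?_⟩
  · have h := dualTrivialization_apply hx ((dualTrivialization F E x₀).symm x (l x)) v
    rw [(dualTrivialization F E x₀).apply_mk_symm (b := x) ⟨hx, trivial⟩] at h
    exact congrArg (χ x * ·) h.symm
  · change ((χ x • (dualTrivialization F E x₀).symm x (l x) :
      E x →L[ℝ] Bundle.Trivial B ℝ x) v : ℝ) = 0
    rw [hx, zero_smul]
    rfl

theorem contMDiffOn_snd_trivialization (x₀ : B) :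
    ContMDiffOn IE 𝓘(ℝ, F) ∞ (fun p : TotalSpace F E => (trivializationAt F E x₀ p).2)
      (TotalSpace.proj ⁻¹' chartBase EB F E x₀) := by
  refine (contDiff_snd.contMDiff.comp_contMDiffOn (contMDiffOn_fibreChart x₀)).congr ?_
  intro p hp
  exact (congrArg Prod.snd (fibreChart_apply x₀ p hp)).symm

/-- The linear vector field with constant coefficients `v` and `C`, cut off by a function on the base. -/
def cutoffField (x₀ : B) {χ : C^∞⟮𝓘(ℝ, EB), B; ℝ⟯} (hχ : tsupport χ ⊆ chartBase EB F E x₀)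
    (v : EB) (C : F →L[ℝ] F) : VectorFields EB F E :=
  ⟨fun p => χ p.proj • (tangentTrivialization EB F E x₀).symm p
      (v, C (trivializationAt F E x₀ p).2),
    contMDiff_cutoff_symm (q := id) contMDiff_id (χ.contMDiff.comp (contMDiff_proj E)) _
      (isOpen_preimage_chartBase x₀) (tsupport_comp_proj_subset hχ)
      (fun p hp => by rw [tangentTrivialization_baseSet]; exact hp)
      (contMDiffOn_const.prodMk_space
        (C.contMDiff.comp_contMDiffOn (contMDiffOn_snd_trivialization x₀)))⟩

theorem mfderiv_cutoffField (x₀ : B) {χ : C^∞⟮𝓘(ℝ, EB), B; ℝ⟯}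
    (hχ : tsupport χ ⊆ chartBase EB F E x₀) (v : EB) (C : F →L[ℝ] F) (f : TotalSpace F E → ℝ)
    (p : TotalSpace F E) :
    mfderiv IE 𝓘(ℝ, ℝ) f p (cutoffField x₀ hχ v C p) =
      χ p.proj • mfderiv IE 𝓘(ℝ, ℝ) f p ((tangentTrivialization EB F E x₀).symm p
        (v, C (trivializationAt F E x₀ p).2)) :=
  map_smul _ _ _

/-- In coordinates the result is `χ ∂_v g`, which does not involve `y`. Outside the chart it is zero
because `χ` vanishes there. -/
theorem exists_mfderiv_cutoffField_pullback (x₀ : B) {χ : C^∞⟮𝓘(ℝ, EB), B; ℝ⟯}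
    (hχ : tsupport χ ⊆ chartBase EB F E x₀) (v : EB) (C : F →L[ℝ] F)
    (g : C^∞⟮𝓘(ℝ, EB), B; ℝ⟯) :
    ∃ h : C^∞⟮𝓘(ℝ, EB), B; ℝ⟯, ∀ p : TotalSpace F E,
      mfderiv IE 𝓘(ℝ, ℝ) (fun q : TotalSpace F E => g q.proj) p (cutoffField x₀ hχ v C p) =
        h p.proj := by
  have hh : ContMDiff 𝓘(ℝ, EB) 𝓘(ℝ, ℝ) ∞ (fun x =>
      χ x * fderiv ℝ (functionCoord EB g x₀) (chartAt EB x₀ x) v) := by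
    refine contMDiff_of_tsupport fun x hx => ?_
    have hx' : x ∈ chartBase EB F E x₀ := hχ (tsupport_mul_subset_left hx)
    have h2 := ((contDiffOn_infty_iff_fderiv_of_isOpen (isOpen_chartDomain x₀)).1
      (contDiffOn_functionCoord (F := F) (E := E) g x₀)).2.clm_apply (contDiffOn_const (c := v))
    have h3 := h2.contMDiffOn.comp (contMDiffOn_chartAt_chartBase x₀)
      fun x hx => chartAt_mem_chartDomain (F := F) (E := E) hx
    exact (χ.contMDiff x).mul (h3.contMDiffAt ((isOpen_chartBase x₀).mem_nhds hx'))
  refine ⟨⟨_, hh⟩, fun p => (mfderiv_cutoffField x₀ hχ v C _ p).trans ?_⟩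
  by_cases hp : p.proj ∈ chartBase EB F E x₀
  · exact congrArg (χ p.proj * ·) (mfderiv_pullback_symm hp g _)
  · have h0 : χ p.proj = 0 := image_eq_zero_of_notMem_tsupport fun h => hp (hχ h)
    have h2 : ∀ a b : ℝ, χ p.proj * a = χ p.proj * b := fun a b => by rw [h0, zero_mul, zero_mul]
    exact h2 _ _

/-- The resulting section of the dual bundle has coordinates `χ (∂_v φ + φ ∘ C)`. -/
theorem exists_mfderiv_cutoffField_pairing (x₀ : B) {χ : C^∞⟮𝓘(ℝ, EB), B; ℝ⟯}
    (hχ : tsupport χ ⊆ chartBase EB F E x₀) (v : EB) (C : F →L[ℝ] F) (φ : DualSections EB F E) :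
    ∃ ψ : DualSections EB F E, ∀ p : TotalSpace F E,
      mfderiv IE 𝓘(ℝ, ℝ) (fun q : TotalSpace F E => (φ q.proj q.2 : ℝ)) p
        (cutoffField x₀ hχ v C p) = ψ p.proj p.2 := by
  have hl : ContMDiffOn 𝓘(ℝ, EB) 𝓘(ℝ, F →L[ℝ] ℝ) ∞
      (fun x => fderiv ℝ (dualCoord EB φ x₀) (chartAt EB x₀ x) v +
        (dualCoord EB φ x₀ (chartAt EB x₀ x)).comp C) (chartBase EB F E x₀) := by
    have h2 := ((contDiffOn_infty_iff_fderiv_of_isOpen (isOpen_chartDomain x₀)).1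
      (contDiffOn_dualCoord φ x₀)).2.clm_apply (contDiffOn_const (c := v))
    have h3 := (contDiffOn_dualCoord φ x₀).clm_comp (contDiffOn_const (c := C))
    have h4 : ContDiffOn ℝ ∞ (fun u => fderiv ℝ (dualCoord EB φ x₀) u v +
      (dualCoord EB φ x₀ u).comp C) (chartDomain EB F E x₀) := h2.add h3
    exact h4.contMDiffOn.comp (contMDiffOn_chartAt_chartBase x₀)
      fun x hx => chartAt_mem_chartDomain (F := F) (E := E) hx
  obtain ⟨ψ, hψ, hψ0⟩ := exists_cutoffDual x₀ hχ hl
  refine ⟨ψ, fun p => (mfderiv_cutoffField x₀ hχ v C _ p).trans ?_⟩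
  by_cases hp : p.proj ∈ chartBase EB F E x₀
  · have h3 := mfderiv_pairing_symm hp φ (v, C (trivializationAt F E x₀ p).2)
      ((contMDiff_pairing φ).mdifferentiable (by simp) p)
    have h4 : ∀ a b : ℝ, a = b → χ p.proj * a = χ p.proj * b := fun a b h => by rw [h]
    exact (h4 _ _ h3).trans (hψ p.proj hp.2 p.2).symm
  · have h0 : χ p.proj = 0 := image_eq_zero_of_notMem_tsupport fun h => hp (hχ h)
    have h2 : ∀ a : ℝ, χ p.proj * a = 0 := fun a => by rw [h0, zero_mul]
    exact (h2 _).trans (hψ0 p.proj h0 p.2).symm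

variable [FiniteDimensional ℝ EB] [T2Space B]

/-- Near a point of the base there are linear vector fields with any given constant coefficients. -/
theorem exists_linearField (x₀ : B) (v : EB) (C : F →L[ℝ] F) :
    ∃ X ∈ linearFields EB F E, ∀ᶠ x in 𝓝 x₀, ∀ p : TotalSpace F E, p.proj = x →
      X p = (tangentTrivialization EB F E x₀).symm p (v, C (trivializationAt F E x₀ p).2) := by
  obtain ⟨χ, h1, hχ⟩ := exists_bump (EB := EB) x₀
    (chartBase_mem_nhds (EB := EB) (F := F) (E := E) x₀)
  refine ⟨cutoffField x₀ hχ v C, ⟨exists_mfderiv_cutoffField_pullback x₀ hχ v C,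
    exists_mfderiv_cutoffField_pairing x₀ hχ v C⟩, ?_⟩
  filter_upwards [h1] with x hx p hp
  have h2 : χ p.proj = 1 := by rw [hp]; exact hx
  refine (congrArg (· • (tangentTrivialization EB F E x₀).symm p
    (v, C (trivializationAt F E x₀ p).2)) h2).trans ?_
  exact one_smul ℝ _

end LinearFields

/-! ### Surjectivity of the multiplication map. -/

section Surjectivity
variable {EB : Type*} [NormedAddCommGroup EB] [NormedSpace ℝ EB] [FiniteDimensional ℝ EB]
  {B : Type*} [TopologicalSpace B] [ChartedSpace EB B] [IsManifold 𝓘(ℝ, EB) ∞ B]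
  [T2Space B]
  {F : Type*} [NormedAddCommGroup F] [NormedSpace ℝ F] [FiniteDimensional ℝ F] {E : B → Type*}
  [TopologicalSpace (TotalSpace F E)] [∀ x, AddCommGroup (E x)] [∀ x, Module ℝ (E x)]
  [∀ x, TopologicalSpace (E x)]
  [∀ x, IsTopologicalAddGroup (E x)] [∀ x, ContinuousSMul ℝ (E x)]
  [FiberBundle F E] [VectorBundle ℝ F E]
  [ContMDiffVectorBundle ∞ F E 𝓘(ℝ, EB)]

local notation "IE" => ModelWithCorners.prod (modelWithCornersSelf ℝ EB) (modelWithCornersSelf ℝ F)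

/-- A smooth function of the coordinates, cut off by a function on the base. -/
def cutoffFunction (x₀ : B) {χ : C^∞⟮𝓘(ℝ, EB), B; ℝ⟯} (hχ : tsupport χ ⊆ chartBase EB F E x₀)
    {b : EB × F → ℝ} (hb : ContDiffOn ℝ ∞ b (chartDomain EB F E x₀ ×ˢ Set.univ)) :
    TotalFunctions EB F E :=
  ⟨fun p => χ p.proj * b (fibreChart EB F E x₀ p), by
    refine contMDiff_of_tsupport fun p hp => ?_
    have hp' : p.proj ∈ chartBase EB F E x₀ :=
      tsupport_comp_proj_subset hχ (tsupport_mul_subset_left hp)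
    have h1 := hb.contMDiffOn.comp (contMDiffOn_fibreChart x₀) fun _ hp => fibreChart_mapsTo hp
    exact ((χ.contMDiff.comp (contMDiff_proj E)) p).mul
      (h1.contMDiffAt ((isOpen_preimage_chartBase x₀).mem_nhds hp'))⟩

/-- The coefficients of a vector field on the total space, in coordinates. -/
def fieldCoord (X : VectorFields EB F E) (x₀ : B) (z : EB × F) : EB × F :=
  (tangentTrivialization EB F E x₀
    ⟨(fibreChart EB F E x₀).symm z, X ((fibreChart EB F E x₀).symm z)⟩).2

theorem mem_tangentTrivialization_baseSet {x₀ : B} {p : TotalSpace F E}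
    (hp : p.proj ∈ chartBase EB F E x₀) : p ∈ (tangentTrivialization EB F E x₀).baseSet := by
  rw [tangentTrivialization_baseSet]; exact hp

theorem contDiffOn_fieldCoord (X : VectorFields EB F E) (x₀ : B) :
    ContDiffOn ℝ ∞ (fieldCoord X x₀) (chartDomain EB F E x₀ ×ˢ Set.univ) := by
  refine contMDiffOn_iff_contDiffOn.1 ?_
  have h := X.contMDiff.comp_contMDiffOn (contMDiffOn_fibreChart_symm x₀)
  refine (((tangentTrivialization EB F E x₀).contMDiffOn_iff ?_).1 h).2
  rintro ⟨u, y⟩ ⟨hu, -⟩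
  exact (tangentTrivialization EB F E x₀).mem_source.2
    (mem_tangentTrivialization_baseSet (fibreChart_symm_proj_mem hu y))

theorem tangentTrivialization_symm_fieldCoord (X : VectorFields EB F E) {x₀ : B}
    {p : TotalSpace F E} (hp : p.proj ∈ chartBase EB F E x₀) :
    (tangentTrivialization EB F E x₀).symm p (fieldCoord X x₀ (fibreChart EB F E x₀ p)) = X p := by
  rw [fieldCoord, fibreChart_left_inv hp]
  exact (tangentTrivialization EB F E x₀).symm_apply_apply_mk
    (mem_tangentTrivialization_baseSet hp) (X p)

theorem tangentTrivialization_apply {x₀ : B} {p : TotalSpace F E}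
    (hp : p.proj ∈ chartBase EB F E x₀) (w : TangentSpace IE p) :
    (tangentTrivialization EB F E x₀ ⟨p, w⟩).2 =
      mfderiv IE 𝓘(ℝ, EB × F) (fibreChart EB F E x₀) p w := by
  have hs : p ∈ (chartAt (ModelProd EB F) (zeroSection F E x₀)).source := by
    rw [← extChartAt_source IE, fibreChart_source]; exact hp
  have h1 := (tangentTrivialization EB F E x₀).coe_linearMapAt_of_mem (R := ℝ)
    (mem_tangentTrivialization_baseSet hp)
  have h2 := TangentBundle.continuousLinearMapAt_trivializationAt (I := IE) hs
  exact (congrFun h1 w).symm.trans (congrArg (fun A : EB × F →L[ℝ] EB × F => A w) h2)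

theorem fibreChart_zeroSection {x₀ x : B} (hx : x ∈ chartBase EB F E x₀) :
    fibreChart EB F E x₀ (zeroSection F E x) = (chartAt EB x₀ x, 0) := by
  rw [fibreChart_apply x₀ _ hx]
  exact congrArg (Prod.mk _) (congrArg Prod.snd ((trivializationAt F E x₀).zeroSection ℝ hx.2))

/-- In the chart the zero section is `u ↦ (u, 0)`, so its fibre component is constant. -/
theorem mfderiv_fibreChart_zeroSection {x₀ x : B} (hx : x ∈ chartBase EB F E x₀)
    (v : TangentSpace 𝓘(ℝ, EB) x) :
    (mfderiv IE 𝓘(ℝ, EB × F) (fibreChart EB F E x₀) (zeroSection F E x)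
      (mfderiv 𝓘(ℝ, EB) IE (zeroSection F E) x v) : EB × F).2 = 0 := by
  have h1 : MDifferentiableAt IE 𝓘(ℝ, EB × F) (fibreChart EB F E x₀) (zeroSection F E x) :=
    ((contMDiffOn_fibreChart x₀).contMDiffAt
      ((isOpen_preimage_chartBase x₀).mem_nhds hx)).mdifferentiableAt (by simp)
  have h2 : MDifferentiableAt 𝓘(ℝ, EB) IE (zeroSection F E) x :=
    (contMDiff_zeroSection (IB := 𝓘(ℝ, EB)) (F := F) (n := ∞) ℝ E).mdifferentiable (by simp) x
  have h3 : HasMFDerivAt 𝓘(ℝ, EB × F) 𝓘(ℝ, F) Prod.snd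
      (fibreChart EB F E x₀ (zeroSection F E x)) (ContinuousLinearMap.snd ℝ EB F) :=
    (ContinuousLinearMap.snd ℝ EB F).hasMFDerivAt
  have h4 := h3.comp x (h1.hasMFDerivAt.comp x h2.hasMFDerivAt)
  have h5 : Prod.snd ∘ (fibreChart EB F E x₀ : TotalSpace F E → EB × F) ∘ zeroSection F E
      =ᶠ[𝓝 x] fun _ => (0 : F) := by
    filter_upwards [(isOpen_chartBase x₀).mem_nhds hx] with x' hx'
    exact congrArg Prod.snd (fibreChart_zeroSection hx')
  have h6 := h4.mfderiv.symm.trans ((h5.mfderiv_eq (I := 𝓘(ℝ, EB)) (I' := 𝓘(ℝ, F))).trans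
    (hasMFDerivAt_const (I := 𝓘(ℝ, EB)) (I' := 𝓘(ℝ, F)) (0 : F) x).mfderiv)
  exact congrArg (fun A : EB →L[ℝ] F => A v) h6

/-- Tangency along the zero section enters here, as the vanishing hypothesis of Hadamard's lemma for
the fibre component. -/
theorem fieldCoord_zero_snd {X : VectorFields EB F E} (hX : X ∈ tangentFields EB F E) (x₀ : B)
    {u : EB} (hu : u ∈ chartDomain EB F E x₀) : (fieldCoord X x₀ (u, 0)).2 = 0 := by
  have hx := chartAt_symm_mem hu
  have hu' : chartAt EB x₀ ((chartAt EB x₀).symm u) = u := (chartAt EB x₀).right_inv (by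
    have := hu.1
    simpa using this)
  have h1 : (fibreChart EB F E x₀).symm (u, 0) = zeroSection F E ((chartAt EB x₀).symm u) := by
    have h2 := fibreChart_zeroSection (F := F) (E := E) hx
    rw [hu'] at h2
    rw [← h2]
    exact fibreChart_left_inv hx
  obtain ⟨v, hv⟩ := hX ((chartAt EB x₀).symm u)
  rw [fieldCoord, h1, ← hv, tangentTrivialization_apply hx]
  exact mfderiv_fibreChart_zeroSection hx v

/-- A field tangent to the zero section is, in coordinates, a combination of linear fields with smooth
coefficients. -/
theorem exists_fieldCoord_eq {X : VectorFields EB F E} (hX : X ∈ tangentFields EB F E) (x₀ : B) :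
    ∃ m : EB × F → EB × (F →L[ℝ] F), ContDiffOn ℝ ∞ m (chartDomain EB F E x₀ ×ˢ Set.univ) ∧
      ∀ u ∈ chartDomain EB F E x₀, ∀ y, fieldCoord X x₀ (u, y) = ((m (u, y)).1, (m (u, y)).2 y) := by
  have h := contDiffOn_fieldCoord X x₀
  obtain ⟨C, hC, hC'⟩ := exists_contDiffOn_linear_of_zero (isOpen_chartDomain x₀)
    (contDiff_snd.comp_contDiffOn h) fun u hu => fieldCoord_zero_snd hX x₀ hu
  -- The base component is kept as it is; only the fibre component has to be linear in `y` up to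
  -- coefficients.
  refine ⟨fun z => ((fieldCoord X x₀ z).1, C z), (contDiff_fst.comp_contDiffOn h).prodMk hC, ?_⟩
  intro u hu y
  exact Prod.ext rfl (hC' u hu y)

theorem span_le_glSections {τ : ∀ p : TotalSpace F E, GlFibre EB F E p.proj}
    (hτ : τ ∈ Submodule.span (TotalFunctions EB F E)
      (Set.range (pullbackLinear (EB := EB) (F := F) (E := E)))) : τ ∈ glSections EB F E :=
  fun _ => ⟨τ, hτ, Eventually.of_forall fun _ => rfl⟩

/-- Evaluation of a field along a fibre at a point. -/
def evaluateLinear (p : TotalSpace F E) : GlFibre EB F E p.proj →ₗ[ℝ] TangentSpace IE p where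
  toFun σ := σ.1 p.2
  map_add' _ _ := rfl
  map_smul' _ _ := rfl

/-- For fixed `y` the map `m ↦ (m.1, m.2 y)` is linear, and so is the inverse trivialization at `p`;
hence both commute with the expansion in a basis. -/
theorem tangentTrivialization_symm_sum {x₀ : B} {p : TotalSpace F E}
    (hp : p.proj ∈ chartBase EB F E x₀) {ι : Type*} [Fintype ι]
    (b : Module.Basis ι ℝ (EB × (F →L[ℝ] F))) (m : EB × (F →L[ℝ] F)) (y : F) :
    ∑ i, b.repr m i • (tangentTrivialization EB F E x₀).symm p ((b i).1, (b i).2 y) =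
      (tangentTrivialization EB F E x₀).symm p (m.1, m.2 y) := by
  let Λ : EB × (F →L[ℝ] F) →ₗ[ℝ] EB × F :=
    { toFun := fun m => (m.1, m.2 y), map_add' := fun _ _ => rfl, map_smul' := fun _ _ => rfl }
  let S := (tangentTrivialization EB F E x₀).symmL ℝ p
  have hS : ∀ w, S w = (tangentTrivialization EB F E x₀).symm p w := fun w =>
    (tangentTrivialization EB F E x₀).symmL_apply (R := ℝ)
      (mem_tangentTrivialization_baseSet hp) w
  have h1 : S (Λ (∑ i, b.repr m i • b i)) = ∑ i, b.repr m i • S (Λ (b i)) := by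
    rw [map_sum, map_sum]
    exact Finset.sum_congr rfl fun i _ => by rw [map_smul, map_smul]
  rw [b.sum_repr] at h1
  rw [← hS]
  refine Eq.trans ?_ h1.symm
  exact Finset.sum_congr rfl fun i _ => by rw [← hS]; rfl

/-- Expand the coefficient `m(u, y)` of `X` in a basis of `EB × End F`. The basis elements are
realised near `x₀` by linear fields, and the components of `m`, cut off, become elements of
`C^∞(E)`. -/
theorem exists_local_glSection {X : VectorFields EB F E} (hX : X ∈ tangentFields EB F E) (x₀ : B) :
    ∃ σ ∈ glSections EB F E, ∀ᶠ x in 𝓝 x₀, ∀ p : TotalSpace F E, p.proj = x →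
      evaluateLinear p (σ p) = X p := by
  obtain ⟨m, hm, hm'⟩ := exists_fieldCoord_eq hX x₀
  obtain ⟨χ, h1, hχ⟩ := exists_bump (EB := EB) x₀
    (chartBase_mem_nhds (EB := EB) (F := F) (E := E) x₀)
  let b := Module.finBasis ℝ (EB × (F →L[ℝ] F))
  choose Y hY hY' using fun i => exists_linearField (E := E) x₀ (b i).1 (b i).2
  let f := fun i => cutoffFunction x₀ hχ
    ((LinearMap.toContinuousLinearMap (b.coord i)).contDiff.comp_contDiffOn hm)
  refine ⟨∑ i, f i • pullbackLinear ⟨Y i, hY i⟩, span_le_glSections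
    (Submodule.sum_mem _ fun i _ => Submodule.smul_mem _ _
      (Submodule.subset_span (Set.mem_range_self _))), ?_⟩
  filter_upwards [h1, eventually_all.2 hY',
    chartBase_mem_nhds (EB := EB) (F := F) (E := E) x₀] with x hx1 hxY hx p hp
  subst hp
  rw [Finset.sum_apply, map_sum]
  have hf : ∀ i, f i p = b.repr (m (fibreChart EB F E x₀ p)) i := fun i => by
    change χ p.proj * b.repr (m (fibreChart EB F E x₀ p)) i = _
    rw [hx1, one_mul]
  have hterm : ∀ i, evaluateLinear p ((f i • pullbackLinear (⟨Y i, hY i⟩ : linearFields EB F E)) p) =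
      b.repr (m (fibreChart EB F E x₀ p)) i •
        (tangentTrivialization EB F E x₀).symm p ((b i).1, (b i).2 (trivializationAt F E x₀ p).2) := by
    intro i
    rw [← hf i, ← hxY i p rfl]
    rfl
  rw [Finset.sum_congr rfl fun i _ => hterm i, tangentTrivialization_symm_sum hx b,
    ← tangentTrivialization_symm_fieldCoord X hx]
  congr 1
  have h3 := hm' _ (fibreChart_mapsTo hx).1 (fibreChart EB F E x₀ p).2
  rw [Prod.mk.eta] at h3
  rw [h3, fibreChart_apply x₀ p hx]

variable (EB F E) in
/-- The multiplication map is surjective. -/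
theorem anchor_surjective [SecondCountableTopology B] :
    Function.Surjective (anchor EB F E) := by
  rintro ⟨X, hX⟩
  obtain ⟨σ, hσ, h⟩ := exists_solution_of_local (glSections EB F E) glSections_of_local
    evaluateLinear (fun p => X p) (exists_local_glSection hX)
  exact ⟨⟨σ, hσ⟩, Subtype.ext (ContMDiffSection.ext h)⟩

end Surjectivity

/-! ### Linear fields along one fibre that vanish at a point. -/

section Kernel
variable {EB : Type*} [NormedAddCommGroup EB] [NormedSpace ℝ EB] [FiniteDimensional ℝ EB]
  {B : Type*} [TopologicalSpace B] [ChartedSpace EB B] [IsManifold 𝓘(ℝ, EB) ∞ B] [T2Space B]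
  {F : Type*} [NormedAddCommGroup F] [NormedSpace ℝ F] [FiniteDimensional ℝ F] {E : B → Type*}
  [TopologicalSpace (TotalSpace F E)] [∀ x, AddCommGroup (E x)] [∀ x, Module ℝ (E x)]
  [∀ x, TopologicalSpace (E x)]
  [∀ x, IsTopologicalAddGroup (E x)] [∀ x, ContinuousSMul ℝ (E x)]
  [FiberBundle F E] [VectorBundle ℝ F E]
  [ContMDiffVectorBundle ∞ F E 𝓘(ℝ, EB)]

local notation "IE" => ModelWithCorners.prod (modelWithCornersSelf ℝ EB) (modelWithCornersSelf ℝ F)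

theorem verticalLift_eq_zero_iff {p : TotalSpace F E} {v : E p.proj} :
    verticalLift EB p v = 0 ↔ v = 0 := by
  constructor
  · intro h
    rw [verticalLift_eq] at h
    have h1 : (trivializationAt F E p.proj).continuousLinearMapAt ℝ p.proj v = 0 :=
      congrArg (fun w : EB × F => w.2) h
    have hx := FiberBundle.mem_baseSet_trivializationAt' (F := F) (E := E) p.proj
    have h2 := (trivializationAt F E p.proj).symmL_continuousLinearMapAt (R := ℝ) hx v
    rw [← h2, h1, map_zero]
  · rintro rfl
    rw [verticalLift_eq, map_zero]
    rfl

theorem mfderiv_pairing_verticalLift (φ : DualSections EB F E) (p : TotalSpace F E)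
    (v : E p.proj) :
    mfderiv IE 𝓘(ℝ, ℝ) (fun q : TotalSpace F E => (φ q.proj q.2 : ℝ)) p (verticalLift EB p v) =
      φ p.proj v := by
  refine (mfderiv_verticalLift ((contMDiff_pairing φ).mdifferentiable (by simp) p) _).trans ?_
  have : (fun t : ℝ => (φ p.proj (p.2 + t • v) : ℝ)) =
      fun t : ℝ => (φ p.proj p.2 : ℝ) + t * (φ p.proj v : ℝ) := by
    funext t
    rw [map_add, map_smul]
    rfl
  refine (congrArg (fun f : ℝ → ℝ => deriv f 0) this).trans ?_
  rw [deriv_const_add, deriv_mul_const differentiableAt_id]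
  simp

/-- The chart is affine along fibres: the line `p + t v` becomes a straight line whose velocity has
no base component. `verticalLift_eq` covers only the trivialization at the base point of `p` itself.
-/
theorem tangentTrivialization_verticalLift {x₀ : B} {p : TotalSpace F E}
    (hp : p.proj ∈ chartBase EB F E x₀) (v : E p.proj) :
    (tangentTrivialization EB F E x₀).symm p (0, (trivializationAt F E x₀ ⟨p.proj, v⟩).2) =
      verticalLift EB p v := by
  have hb := mem_tangentTrivialization_baseSet hp
  suffices h : (tangentTrivialization EB F E x₀ ⟨p, verticalLift EB p v⟩).2 =
      (0, (trivializationAt F E x₀ ⟨p.proj, v⟩).2) by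
    rw [← h]
    exact (tangentTrivialization EB F E x₀).symm_apply_apply_mk hb _
  rw [tangentTrivialization_apply hp]
  -- Testing with functionals reduces the claim to real functions, for which `mfderiv_verticalLift`
  -- computes the derivative along the line.
  refine (SeparatingDual.eq_iff_forall_dual_eq (R := ℝ) (V := EB × F)).2 fun l => ?_
  have h1 : MDifferentiableAt IE 𝓘(ℝ, EB × F) (fibreChart EB F E x₀) p :=
    ((contMDiffOn_fibreChart x₀).contMDiffAt
      ((isOpen_preimage_chartBase x₀).mem_nhds hp)).mdifferentiableAt (by simp)
  have h2 := (l.hasMFDerivAt (x := fibreChart EB F E x₀ p)).comp p h1.hasMFDerivAt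
  have h3 := mfderiv_verticalLift h2.mdifferentiableAt v
  rw [h2.mfderiv] at h3
  refine h3.trans ?_
  have hline : ∀ t : ℝ, (l ∘ fibreChart EB F E x₀)
      (⟨p.proj, p.2 + t • v⟩ : TotalSpace F E) =
      l (fibreChart EB F E x₀ p) + t * l (0, (trivializationAt F E x₀ ⟨p.proj, v⟩).2) := by
    intro t
    have hlin := (trivializationAt F E x₀).linear ℝ hp.2
    have h4 : (trivializationAt F E x₀ ⟨p.proj, p.2 + t • v⟩).2 =
        (trivializationAt F E x₀ p).2 + t • (trivializationAt F E x₀ ⟨p.proj, v⟩).2 :=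
      (hlin.1 _ _).trans (congrArg _ (hlin.2 _ _))
    rw [Function.comp, fibreChart_apply x₀ ⟨p.proj, p.2 + t • v⟩ hp, h4,
      fibreChart_apply x₀ p hp, ← smul_eq_mul, ← map_smul, ← map_add]
    simp
  rw [funext hline, deriv_const_add, deriv_mul_const differentiableAt_id]
  simp
  rfl

/-- Every functional on the model fibre is the coordinate at `x` of a global section of the dual
bundle, so these sections separate vectors. -/
theorem eq_zero_of_forall_pairing_eq_zero {x : B} {v : E x}
    (h : ∀ φ : DualSections EB F E, (φ x v : ℝ) = 0) : v = 0 := by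
  have hx := FiberBundle.mem_baseSet_trivializationAt' (F := F) (E := E) x
  refine trivialization_inj (G := F) (e := trivializationAt F E x) hx ?_
  refine Eq.trans ?_ ((trivializationAt F E x).linear ℝ hx).map_zero.symm
  refine SeparatingDual.eq_zero_of_forall_dual_eq_zero (R := ℝ) fun l => ?_
  obtain ⟨φ, hφ⟩ := exists_section (EB := EB) (G := F →L[ℝ] ℝ)
    (V := fun x : B => E x →L[ℝ] Bundle.Trivial B ℝ x) x l
  have h1 := dualTrivialization_apply hx (φ x) v
  rw [hφ.self_of_nhds] at h1
  exact h1.trans (h φ)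

/-- Such functions detect the base component of a tangent vector over `x₀`. -/
theorem exists_functionCoord_eventuallyEq (x₀ : B) (l : EB →L[ℝ] ℝ) :
    ∃ g : C^∞⟮𝓘(ℝ, EB), B; ℝ⟯, functionCoord EB g x₀ =ᶠ[𝓝 (chartAt EB x₀ x₀)] l := by
  obtain ⟨χ, h1, hχ⟩ := exists_bump (EB := EB) x₀
    ((chartAt EB x₀).open_source.mem_nhds (mem_chart_source EB x₀))
  have hg : ContMDiff 𝓘(ℝ, EB) 𝓘(ℝ, ℝ) ∞ fun x => χ x * l (chartAt EB x₀ x) := by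
    refine contMDiff_of_tsupport fun x hx => ?_
    have hx' := hχ (tsupport_mul_subset_left hx)
    exact (χ.contMDiff x).mul ((l.contMDiff _).comp x
      ((contMDiffOn_extChartAt (I := 𝓘(ℝ, EB)) (n := ∞) (x := x₀)).contMDiffAt
        ((chartAt EB x₀).open_source.mem_nhds hx')))
  refine ⟨⟨_, hg⟩, ?_⟩
  have hmem := mem_chart_target EB x₀
  have hc : ContinuousAt (chartAt EB x₀).symm (chartAt EB x₀ x₀) :=
    (chartAt EB x₀).continuousAt_symm hmem
  have hc' : Tendsto (chartAt EB x₀).symm (𝓝 (chartAt EB x₀ x₀)) (𝓝 x₀) := by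
    have := hc.tendsto
    rwa [(chartAt EB x₀).left_inv (mem_chart_source EB x₀)] at this
  filter_upwards [hc'.eventually h1, (chartAt EB x₀).open_target.mem_nhds hmem] with u hu hu'
  change χ ((chartAt EB x₀).symm u) * l (chartAt EB x₀ ((chartAt EB x₀).symm u)) = l u
  rw [hu, one_mul, (chartAt EB x₀).right_inv hu']

/-- A linear field which vanishes at one point of a fibre is vertical along the fibre. -/
theorem exists_verticalLift_of_eval_eq_zero {X : VectorFields EB F E}
    (hX : X ∈ linearFields EB F E) {x : B} {e₀ : E x} (h0 : X ⟨x, e₀⟩ = 0) (e : E x) :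
    ∃ v : E x, X ⟨x, e⟩ = verticalLift EB (⟨x, e⟩ : TotalSpace F E) v := by
  have hx : x ∈ chartBase EB F E x := mem_of_mem_nhds (chartBase_mem_nhds x)
  let p : TotalSpace F E := ⟨x, e⟩
  have hp : p.proj ∈ chartBase EB F E x := hx
  set w := fieldCoord X x (fibreChart EB F E x p) with hw
  have hXw : (tangentTrivialization EB F E x).symm p w = X p :=
    tangentTrivialization_symm_fieldCoord X hp
  -- For `g` on the base, `X(g ∘ π)` is constant along the fibre and zero at `e₀`, hence zero at
  -- `e`; with `g` linear near `x` it is a coordinate of the base component.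
  have hw1 : w.1 = 0 := by
    refine SeparatingDual.eq_zero_of_forall_dual_eq_zero (R := ℝ) fun l => ?_
    obtain ⟨g, hg⟩ := exists_functionCoord_eventuallyEq x l
    obtain ⟨h, hh⟩ := hX.1 g
    have h1 : h x = 0 := by
      refine (hh ⟨x, e₀⟩).symm.trans ?_
      rw [h0]
      exact map_zero _
    have h2 := mfderiv_pullback_symm hp g w
    rw [hXw, hg.fderiv_eq, l.fderiv] at h2
    exact h2.symm.trans ((hh p).trans h1)
  refine ⟨(trivializationAt F E x).symm x w.2, ?_⟩
  refine Eq.trans ?_ (tangentTrivialization_verticalLift hp _)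
  rw [(trivializationAt F E x).apply_mk_symm hx.2, ← hw1]
  exact hXw.symm

/-- The field along the fibre is the lift of some `V e`. Since it preserves fibrewise linear
functions, `φ (V e)` is linear in `e` for every section `φ` of the dual bundle, and these separate
vectors; so `V` is linear. -/
theorem exists_endFibre_of_eval_eq_zero {x : B} (w : GlFibre EB F E x) {e₀ : E x}
    (h0 : w.1 e₀ = 0) : ∃ A : E x →L[ℝ] E x, endFibre EB F E x A = w := by
  obtain ⟨X, hX, hw⟩ := w.2
  have hwX : ∀ e : E x, w.1 e = X ⟨x, e⟩ := fun e => (congrFun hw e).symm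
  choose V hV using fun e => exists_verticalLift_of_eval_eq_zero hX ((hwX e₀).symm.trans h0) e
  have hpair : ∀ φ : DualSections EB F E, ∃ ψ : E x →L[ℝ] ℝ, ∀ e, (φ x (V e) : ℝ) = ψ e := by
    intro φ
    obtain ⟨ψ, hψ⟩ := hX.2 φ
    refine ⟨ψ x, fun e => ?_⟩
    refine Eq.trans ?_ (hψ ⟨x, e⟩)
    rw [hV e]
    exact (mfderiv_pairing_verticalLift φ ⟨x, e⟩ (V e)).symm
  have hφ : ∀ (φ : DualSections EB F E) (a b : E x), (φ x (a - b) : ℝ) = φ x a - φ x b :=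
    fun φ a b => map_sub _ _ _
  let A₀ : E x →ₗ[ℝ] E x :=
    { toFun := V
      map_add' := fun a b => by
        refine sub_eq_zero.1 (eq_zero_of_forall_pairing_eq_zero (EB := EB) (F := F) fun φ => ?_)
        obtain ⟨ψ, hψ⟩ := hpair φ
        have h1 : (φ x (V a + V b) : ℝ) = φ x (V a) + φ x (V b) := map_add _ _ _
        rw [hφ, h1, hψ, hψ, hψ, map_add, sub_self]
      map_smul' := fun c a => by
        refine sub_eq_zero.1 (eq_zero_of_forall_pairing_eq_zero (EB := EB) (F := F) fun φ => ?_)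
        obtain ⟨ψ, hψ⟩ := hpair φ
        have h1 : (φ x (c • V a) : ℝ) = c * φ x (V a) := map_smul _ _ _
        rw [hφ, RingHom.id_apply, h1, hψ, hψ, map_smul, smul_eq_mul, sub_self] }
  have hx := FiberBundle.mem_baseSet_trivializationAt' (F := F) (E := E) x
  let L := (trivializationAt F E x).continuousLinearEquivAt ℝ x hx
  -- Continuity is obtained on the model fibre `F`, a finite-dimensional normed space, and carried
  -- back by the trivialization.
  let A : E x →L[ℝ] E x := (L.symm : F →L[ℝ] E x).comp
    ((LinearMap.toContinuousLinearMap
      (L.toLinearEquiv.toLinearMap ∘ₗ A₀ ∘ₗ L.symm.toLinearEquiv.toLinearMap)).comp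
        (L : E x →L[ℝ] F))
  have hA : ∀ e, A e = V e := fun e => by
    change L.symm (L (V (L.symm (L e)))) = V e
    rw [L.symm_apply_apply, L.symm_apply_apply]
  -- The sign compensates the one in `a(A) : e ↦ -A e`.
  refine ⟨-A, Subtype.ext (funext fun e => ?_)⟩
  refine Eq.trans ?_ ((hwX e).trans (hV e)).symm
  change verticalLift EB (⟨x, e⟩ : TotalSpace F E) (-(-A e)) = _
  rw [neg_neg, hA]

end Kernel

/-! ### Smoothness of the endomorphism, and assembly of the complex. -/

section Exactness
variable {EB : Type*} [NormedAddCommGroup EB] [NormedSpace ℝ EB] [FiniteDimensional ℝ EB]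
  {B : Type*} [TopologicalSpace B] [ChartedSpace EB B] [IsManifold 𝓘(ℝ, EB) ∞ B] [T2Space B]
  {F : Type*} [NormedAddCommGroup F] [NormedSpace ℝ F] [FiniteDimensional ℝ F] {E : B → Type*}
  [TopologicalSpace (TotalSpace F E)] [∀ x, AddCommGroup (E x)] [∀ x, Module ℝ (E x)]
  [∀ x, TopologicalSpace (E x)]
  [∀ x, IsTopologicalAddGroup (E x)] [∀ x, ContinuousSMul ℝ (E x)]
  [FiberBundle F E] [VectorBundle ℝ F E]
  [ContMDiffVectorBundle ∞ F E 𝓘(ℝ, EB)]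

local notation "IE" => ModelWithCorners.prod (modelWithCornersSelf ℝ EB) (modelWithCornersSelf ℝ F)

/-- Applying a combination of linear fields to a fibrewise linear function gives a fibrewise linear
function. -/
theorem exists_pairing_of_mem_span (φ : DualSections EB F E)
    {τ : ∀ p : TotalSpace F E, GlFibre EB F E p.proj}
    (hτ : τ ∈ Submodule.span (TotalFunctions EB F E)
      (Set.range (pullbackLinear (EB := EB) (F := F) (E := E)))) :
    ∃ Ψ ∈ pullbackSections EB F E (F →L[ℝ] ℝ) (fun x : B => E x →L[ℝ] Bundle.Trivial B ℝ x),
      ∀ (p : TotalSpace F E) (e : E p.proj),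
        mfderiv IE 𝓘(ℝ, ℝ) (fun q : TotalSpace F E => (φ q.proj q.2 : ℝ))
          (⟨p.proj, e⟩ : TotalSpace F E) ((τ p).1 e) = Ψ p e := by
  induction hτ using Submodule.span_induction with
  | mem τ h =>
    obtain ⟨X, rfl⟩ := h
    obtain ⟨ψ, hψ⟩ := X.2.2 φ
    exact ⟨fun p => ψ p.proj, ψ.contMDiff.comp (contMDiff_proj E), fun p e => hψ ⟨p.proj, e⟩⟩
  | zero => exact ⟨0, Submodule.zero_mem _, fun p e => map_zero _⟩
  | add τ τ' _ _ h h' =>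
    obtain ⟨Ψ, hΨ, hp⟩ := h
    obtain ⟨Ψ', hΨ', hp'⟩ := h'
    exact ⟨Ψ + Ψ', Submodule.add_mem _ hΨ hΨ', fun p e =>
      (map_add _ _ _).trans (congrArg₂ (· + ·) (hp p e) (hp' p e))⟩
  | smul f τ _ h =>
    obtain ⟨Ψ, hΨ, hp⟩ := h
    exact ⟨f • Ψ, Submodule.smul_mem _ f hΨ, fun p e =>
      (map_smul _ _ _).trans (congrArg (f p • ·) (hp p e))⟩

/-- Differentiating the fibrewise linear function `φ` along the vertical field of `A p` gives `-φ ∘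
A p`. The statement is local because sections of `π* gl(E)` are only locally combinations of linear
fields. -/
theorem exists_pairing_endFibre (φ : DualSections EB F E)
    {A : ∀ p : TotalSpace F E, E p.proj →L[ℝ] E p.proj}
    (hA : (fun p : TotalSpace F E => endFibre EB F E p.proj (A p)) ∈ glSections EB F E)
    (p₀ : TotalSpace F E) :
    ∃ Ψ ∈ pullbackSections EB F E (F →L[ℝ] ℝ) (fun x : B => E x →L[ℝ] Bundle.Trivial B ℝ x),
      ∀ᶠ p : TotalSpace F E in 𝓝 p₀, ∀ e : E p.proj, (φ p.proj (A p e) : ℝ) = -(Ψ p e : ℝ) := by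
  obtain ⟨τ, hτ, hp⟩ := hA p₀
  obtain ⟨Ψ, hΨ, h⟩ := exists_pairing_of_mem_span φ hτ
  refine ⟨Ψ, hΨ, ?_⟩
  filter_upwards [hp] with p hp e
  have h1 := h p e
  rw [← hp] at h1
  have h2 := (mfderiv_pairing_verticalLift φ (⟨p.proj, e⟩ : TotalSpace F E) (-(A p e))).symm.trans h1
  have h3 : (φ p.proj (-(A p e)) : ℝ) = -(φ p.proj (A p e) : ℝ) := map_neg _ _
  exact neg_eq_iff_eq_neg.1 (h3.symm.trans h2)

variable (F) in
/-- The endomorphism with given components in a basis. -/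
def ofComponents {ι : Type*} [Fintype ι] (c : Module.Basis ι ℝ F) :
    (ι → F →L[ℝ] ℝ) →L[ℝ] (F →L[ℝ] F) :=
  ∑ j, ((ContinuousLinearMap.smulRightL ℝ F F).flip (c j)).comp (ContinuousLinearMap.proj j)

theorem ofComponents_apply {ι : Type*} [Fintype ι] (c : Module.Basis ι ℝ F)
    (l : ι → F →L[ℝ] ℝ) (y : F) : ofComponents F c l y = ∑ j, l j y • c j := by
  simp [ofComponents]

/-- Near `p₀` take sections `φ j` of the dual bundle whose coordinates are the constant dual basis.
The rows `φ j ∘ A` of the matrix of `A` are smooth by `exists_pairing_endFibre`, and `ofComponents`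
reassembles `A` from them. -/
theorem mem_pullbackSections_of_endFibre {A : ∀ p : TotalSpace F E, E p.proj →L[ℝ] E p.proj}
    (hA : (fun p : TotalSpace F E => endFibre EB F E p.proj (A p)) ∈ glSections EB F E) :
    A ∈ pullbackSections EB F E (F →L[ℝ] F) (fun x : B => E x →L[ℝ] E x) := by
  intro p₀
  refine contMDiffAt_totalSpace.2 ⟨contMDiff_proj E p₀, ?_⟩
  let c := Module.finBasis ℝ F
  choose φ hφ using fun j => exists_section (EB := EB) (G := F →L[ℝ] ℝ)
    (V := fun x : B => E x →L[ℝ] Bundle.Trivial B ℝ x) p₀.proj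
    (LinearMap.toContinuousLinearMap (c.coord j))
  choose Ψ hΨ hΨA using fun j => exists_pairing_endFibre (φ j) hA p₀
  have h1 : ContMDiffAt IE 𝓘(ℝ, Fin (Module.finrank ℝ F) → F →L[ℝ] ℝ) ∞
      (fun p : TotalSpace F E => fun j => -(dualTrivialization F E p₀.proj ⟨p.proj, Ψ j p⟩).2) p₀ :=
    contMDiffAt_pi_space.2 fun j => (contMDiffAt_totalSpace.1 (hΨ j p₀)).2.neg
  have h2 := ((ofComponents F c).contMDiff _).comp p₀ h1
  refine h2.congr_of_eventuallyEq ?_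
  have hcont := (FiberBundle.continuous_proj F E).continuousAt (x := p₀)
  filter_upwards [hcont.eventually (eventually_all.2 hφ), eventually_all.2 hΨA,
    hcont.preimage_mem_nhds (chartBase_mem_nhds (EB := EB) (F := F) (E := E) p₀.proj)]
    with p hφp hAp hp
  have hx : p.proj ∈ (trivializationAt F E p₀.proj).baseSet := hp.2
  refine ContinuousLinearMap.ext fun y => ?_
  refine Eq.trans ?_ (ofComponents_apply c _ y).symm
  set v := (trivializationAt F E p₀.proj).symm p.proj y with hv
  have hy : (trivializationAt F E p₀.proj ⟨p.proj, v⟩).2 = y := by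
    rw [hv, (trivializationAt F E p₀.proj).apply_mk_symm hx]
  have h3 : (trivializationAt (F →L[ℝ] F) (fun x : B => E x →L[ℝ] E x) p₀.proj
      ⟨p.proj, A p⟩).2 y = (trivializationAt F E p₀.proj ⟨p.proj, A p v⟩).2 := by
    change ContinuousLinearMap.inCoordinates F E F E p₀.proj p.proj p₀.proj p.proj (A p) y = _
    simp [ContinuousLinearMap.inCoordinates, hx, hv]
  refine h3.trans ((c.sum_repr _).symm.trans (Finset.sum_congr rfl fun j _ => ?_))
  refine congrArg (· • c j) ?_
  have h4 := dualTrivialization_apply hx (φ j p.proj) (A p v)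
  rw [hφp j] at h4
  have h5 := dualTrivialization_apply hx (Ψ j p) v
  rw [hy] at h5
  exact h4.trans ((hAp j v).trans (congrArg Neg.neg h5.symm))

/-- The identification `End E = ⋀¹E* ⊗ E`, on a fibre. -/
def altOfLinear {x : B} (A : E x →L[ℝ] E x) : E x [⋀^Fin 1]→L[ℝ] E x :=
  ContinuousAlternatingMap.ofSubsingleton ℝ (E x) (E x) (0 : Fin 1) A

theorem linearOfAlt_altOfLinear {x : B} (A : E x →L[ℝ] E x) : linearOfAlt (altOfLinear A) = A :=
  (ContinuousAlternatingMap.ofSubsingleton ℝ (E x) (E x) (0 : Fin 1)).symm_apply_apply A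

theorem altOfLinear_linearOfAlt {x : B} (α : E x [⋀^Fin 1]→L[ℝ] E x) :
    altOfLinear (linearOfAlt α) = α :=
  (ContinuousAlternatingMap.ofSubsingleton ℝ (E x) (E x) (0 : Fin 1)).apply_symm_apply α

theorem altOfLinear_mem {A : ∀ p : TotalSpace F E, E p.proj →L[ℝ] E p.proj}
    (hA : A ∈ pullbackSections EB F E (F →L[ℝ] F) (fun x : B => E x →L[ℝ] E x)) :
    (fun p => altOfLinear (A p)) ∈ AltSections EB F E 1 := by
  intro p₀
  have h2 := contMDiffAt_totalSpace.1 (hA p₀)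
  refine contMDiffAt_totalSpace.2 ⟨h2.1, ?_⟩
  have h3 : ContMDiffAt IE 𝓘(ℝ, F [⋀^Fin 1]→L[ℝ] F) ∞ _ p₀ :=
    ((ContinuousAlternatingMap.ofSubsingletonLIE (𝕜 := ℝ) (E := F) (F := F)
      (0 : Fin 1)).toContinuousLinearEquiv.toContinuousLinearMap.contMDiff _).comp p₀ h2.2
  exact h3

theorem endFibre_injective (x : B) : Function.Injective (endFibre EB F E x) := by
  refine (injective_iff_map_eq_zero _).2 fun A hA => ContinuousLinearMap.ext fun e => ?_
  have h : verticalLift EB (⟨x, e⟩ : TotalSpace F E) (-(A e)) = 0 :=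
    congrFun (congrArg Subtype.val hA) e
  exact neg_eq_zero.1 (verticalLift_eq_zero_iff.1 h)

variable (EB F E) in
theorem endInclusion_injective : Function.Injective (endInclusion EB F E) := by
  refine (injective_iff_map_eq_zero _).2 fun α hα => Subtype.ext (funext fun p => ?_)
  have h : endFibre EB F E p.proj (linearOfAlt (α.1 p)) = 0 :=
    congrFun (congrArg Subtype.val hα) p
  have h1 : linearOfAlt (α.1 p) = 0 :=
    endFibre_injective p.proj (h.trans (map_zero _).symm)
  rw [← altOfLinear_linearOfAlt (α.1 p), h1]
  rfl

/-- A section of `π* gl(E)` killed by the multiplication map comes from a section of `π* End E`. -/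
theorem exists_endInclusion_eq {σ : glSections EB F E} (hσ : anchor EB F E σ = 0) :
    ∃ α, endInclusion EB F E α = σ := by
  have h0 : ∀ p : TotalSpace F E, (σ.1 p).1 p.2 = 0 := fun p =>
    congrArg (fun X : tangentFields EB F E => X.1 p) hσ
  -- A pointwise choice is harmless: smoothness of `A` follows from that of its image `σ`.
  choose A hA using fun p : TotalSpace F E => exists_endFibre_of_eval_eq_zero (σ.1 p) (h0 p)
  have hA' : A ∈ pullbackSections EB F E (F →L[ℝ] F) (fun x : B => E x →L[ℝ] E x) := by
    refine mem_pullbackSections_of_endFibre ?_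
    rw [funext hA]
    exact σ.2
  refine ⟨⟨_, altOfLinear_mem hA'⟩, Subtype.ext (funext fun p => ?_)⟩
  refine Eq.trans ?_ (hA p)
  exact congrArg (endFibre EB F E p.proj) (linearOfAlt_altOfLinear (A p))

/-- Both sides say that the endomorphism `α p` kills the vector `p`. Up to sign and vertical lift,
the multiplication map on `π* End E` is the Koszul differential from degree one to degree zero. -/
theorem anchor_endInclusion_eq_zero_iff (α : AltSections EB F E 1) :
    anchor EB F E (endInclusion EB F E α) = 0 ↔ contraction EB F E 0 α = 0 := by
  have key : ∀ p : TotalSpace F E,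
      verticalLift EB p (-(linearOfAlt (α.1 p) p.2)) = 0 ↔ interior p.2 (α.1 p) = 0 := by
    intro p
    rw [verticalLift_eq_zero_iff, neg_eq_zero]
    have h : ∀ w, interior p.2 (α.1 p) w = linearOfAlt (α.1 p) p.2 := fun w =>
      congrArg (α.1 p) (funext fun i => by
        rw [Fin.fin_one_eq_zero i]; rfl)
    exact ⟨fun h1 => ContinuousAlternatingMap.ext fun w => (h w).trans h1,
      fun h1 => (h Fin.elim0).symm.trans (by rw [h1]; rfl)⟩
  constructor
  · intro h
    refine Subtype.ext (funext fun p => (key p).1 ?_)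
    exact congrArg (fun X : tangentFields EB F E => X.1 p) h
  · intro h
    refine Subtype.ext (ContMDiffSection.ext fun p => (key p).2 ?_)
    exact congrFun (congrArg Subtype.val h) p

variable (EB F E) in
-- The kernel of `m` consists of the degree-one Koszul cycles, and these are boundaries by
-- `exact_contraction` in its lowest degree.
theorem exact_endInclusion_anchor [SecondCountableTopology B] :
    Function.Exact (endInclusion EB F E ∘ₗ contraction EB F E 1) (anchor EB F E) := by
  intro σ
  constructor
  · intro hσ
    obtain ⟨α, rfl⟩ := exists_endInclusion_eq hσ
    obtain ⟨β, rfl⟩ := (exact_contraction EB F E 0 α).1 ((anchor_endInclusion_eq_zero_iff α).1 hσ)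
    exact ⟨β, rfl⟩
  · rintro ⟨β, rfl⟩
    exact (anchor_endInclusion_eq_zero_iff _).2 ((exact_contraction EB F E 0 _).2 ⟨β, rfl⟩)

variable (EB F E) in
theorem exact_contraction_endInclusion [SecondCountableTopology B] :
    Function.Exact (contraction EB F E 2) (endInclusion EB F E ∘ₗ contraction EB F E 1) := by
  intro α
  refine Iff.trans ?_ (exact_contraction EB F E 1 α)
  exact map_eq_zero_iff _ (endInclusion_injective EB F E)

variable (EB E) in
-- More vectors than the rank are linearly dependent, and an alternating form vanishes on them.
theorem subsingleton_altSections {k : ℕ} (hk : Module.finrank ℝ F < k) :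
    Subsingleton (AltSections EB F E k) := by
  refine ⟨fun α β => Subtype.ext (funext fun p => ContinuousAlternatingMap.ext fun w => ?_)⟩
  have hx := FiberBundle.mem_baseSet_trivializationAt' (F := F) (E := E) p.proj
  let L := ((trivializationAt F E p.proj).continuousLinearEquivAt ℝ p.proj hx).toLinearEquiv
  have : FiniteDimensional ℝ (E p.proj) := L.symm.finiteDimensional
  have hw : ¬ LinearIndependent ℝ w := fun h => by
    have h1 := h.fintype_card_le_finrank
    rw [Fintype.card_fin, L.finrank_eq] at h1
    omega
  exact ((α.1 p).toAlternatingMap.map_linearDependent w hw).trans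
    ((β.1 p).toAlternatingMap.map_linearDependent w hw).symm

end Exactness

end ZeroSectionFoliation

end

/-- For `n ≥ 2`, injectivity of `d_n` is exactness in degree `n` together with the vanishing of the
module in degree `n + 1`. For `n ≤ 1` the source of `d₂` vanishes, so exactness at `Γ(π* gl(E))`
says that `m` is injective. -/
theorem mainTheorem8
    {EB : Type*} [NormedAddCommGroup EB] [NormedSpace ℝ EB] [FiniteDimensional ℝ EB]
    {L : Type*} [TopologicalSpace L] [ChartedSpace EB L] [IsManifold 𝓘(ℝ, EB) ∞ L]
    [T2Space L] [SecondCountableTopology L]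
    {F : Type*} [NormedAddCommGroup F] [NormedSpace ℝ F] [FiniteDimensional ℝ F]
    {E : L → Type*} [TopologicalSpace (TotalSpace F E)]
    [∀ x, AddCommGroup (E x)] [∀ x, Module ℝ (E x)] [∀ x, TopologicalSpace (E x)]
    [∀ x, IsTopologicalAddGroup (E x)] [∀ x, ContinuousSMul ℝ (E x)]
    [FiberBundle F E] [VectorBundle ℝ F E] [ContMDiffVectorBundle ∞ F E 𝓘(ℝ, EB)]
    (n : ℕ) (hn : Module.finrank ℝ F = n) :
    -- the modules in the places to the left of `k = n` vanish
    (∀ k, n < k → Subsingleton (AltSections EB F E k)) ∧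
    -- exactness at `Γ(π*(⋀ᵏE* ⊗ E))` for `k = j + 3`
    (∀ j : ℕ, Function.Exact (contraction EB F E (j + 3)) (contraction EB F E (j + 2))) ∧
    -- exactness at `Γ(π*(⋀²E* ⊗ E))`
    Function.Exact (contraction EB F E 2) (endInclusion EB F E ∘ₗ contraction EB F E 1) ∧
    -- exactness at `Γ(π* gl(E))`
    Function.Exact (endInclusion EB F E ∘ₗ contraction EB F E 1) (anchor EB F E) ∧
    -- exactness at the foliation
    Function.Surjective (anchor EB F E) := by
  subst hn
  exact ⟨fun k hk => subsingleton_altSections EB E hk, fun j => exact_contraction EB F E (j + 2),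
    exact_contraction_endInclusion EB F E, exact_endInclusion_anchor EB F E,
    anchor_surjective EB F E⟩
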